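/- Let $\mathbb A$ be a finite alphabet and let $Z_i=(X_i,Y_i)$, $i\ge 1$, be a stationary, irreducible and aperiodic Markov chain with state space $\mathbb A\times\mathbb A$ and transition matrix $(p_{\mathbf A\mathbf B})$. Fix a scoring function $S:\mathbb A\times\mathbb A\to[0,\infty)$ and $\delta\in\mathbb R$. For a word $z=((x_1,y_1),\dots,(x_n,y_n))$ let $$L(z)=\max\Big\{\sum_{i=1}^k S(x_{\rho_i},y_{\tau_i})+\delta(n-k)\Big\},$$ the maximum being over all $0\le k\le n$ and all $1\le\rho_1<\dots<\rho_k\le n$, $1\le\tau_1<\dots<\tau_k\le n$; put $L_n=L(Z_1,\dots,Z_n)$. Fix $\mathbf A,\mathbf B,\mathbf D\in\mathbb A\times\mathbb A$ with $P(Z_1=\mathbf A,Z_3=\mathbf B)>0$ and $$q:=\frac{p_{\mathbf A\mathbf D}\,p_{\mathbf D\mathbf B}}{\sum_{\mathbf D'}p_{\mathbf A\mathbf D'}\,p_{\mathbf D'\mathbf B}}>0 .$$ For a word $z$ of length $n$ call $i\in\{1,\dots,\lfloor n/3\rfloor\}$ an $(\mathbf A\cdot\mathbf B)$-triplet if $z_{3i-2}=\mathbf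 A$ and $z_{3i}=\mathbf B$; let $V(z)$ be the number of these triplets and $U(z)$ the number of those among them with $z_{3i-1}=\mathbf D$. The random transformation $\mathcal R$, independent of $Z$, acts as follows: if $U(z)<V(z)$, it chooses uniformly one of the $V(z)-U(z)$ $(\mathbf A\cdot\mathbf B)$-triplets of $z$ whose middle letter is not $\mathbf D$ and changes this middle letter to $\mathbf D$; if $U(z)=V(z)$, it leaves $z$ unchanged. Suppose that $\mathcal R$ satisfies condition A1: there are $\epsilon_o>0$ and a sequence $\Delta_n\to0$ such that, for $Z=(Z_1,\dots,Z_n)$ and every $n$, $$P\big(E[L(\mathcal R(Z))-L(Z)\mid Z]\ge\epsilon_o\big)\ge 1-\Delta_n .$$ (A1 forces $q<1$.) Put $$\alpha=\tfrac13P(Z_1=\mathbf A,Z_3=\mathbf B),\qquad b(q)=\sqrt{2\pi q(1-q)}\,\exp\Big[\frac1{2q(1-q)}\Big],$$ and let $0<c_o<\dfrac{\sqrt{2\alpha}}{8\,b(q)}$. Theorem. Let $\Phi:[0,\infty)\to[0,\infty)$ be convex and non-decreasing and let $(\mu_n)$ be a sequence of reals. Then for every sufficiently large $n$ $$E\,\Phi\big(|L_n-\mu_n|\big)\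 \ge\ c_o\,\Phi\Big(\frac{\epsilon_o\sqrt{2\alpha n}}{16}\Big).$$ In particular, for every real $r\ge1$ and every sufficiently large $n$ (depending on $r$), $$E|L_n-EL_n|^r\ \ge\ c_o\Big(\frac{\epsilon_o\sqrt{2\alpha}}{16}\Big)^r n^{r/2},$$ and for every sufficiently large $n$ $$\mathrm{Var}(L_n)\ \ge\ a_o\,n,\qquad a_o=\frac{2c_o\alpha\,\epsilon_o^2}{16^2}.$$ -/

import Mathlib

open MeasureTheory ProbabilityTheory Filter Topology
open scoped NNReal ENNReal

noncomputable section

namespace PairwiseMarkov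

/-! ### Markov chains with a finite state space -/

section Chains

variable {T : Type*} [Fintype T] [DecidableEq T]

/-- Every state has period one: the only common divisor of the possible return times is `1`. -/
def IsAperiodic (P : Matrix T T ℝ) : Prop :=
  ∀ x : T, ∀ d : ℕ, (∀ k : ℕ, 0 < k → 0 < (P ^ k) x x → d ∣ k) → d = 1

/-- `Z 0, Z 1, …` is a Markov chain on `T` with transition matrix `P` (Markov property in terms of
path probabilities). -/
structure IsMarkovChain {Ω : Type*} [MeasurableSpace Ω] [MeasurableSpace T]
    (μ : Measure Ω) (Z : ℕ → Ω → T) (P : Matrix T T ℝ) : Prop where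
  measurable : ∀ i, Measurable (Z i)
  stochastic : P ∈ Matrix.rowStochastic ℝ T
  markov : ∀ (n : ℕ) (x : ℕ → T),
    μ.real {ω | ∀ i ≤ n + 1, Z i ω = x i} =
      μ.real {ω | ∀ i ≤ n, Z i ω = x i} * P (x n) (x (n + 1))

/-- Stationarity: the shifted process has the same law as the process. -/
def IsStationaryProcess {Ω : Type*} [MeasurableSpace Ω] [MeasurableSpace T]
    (μ : Measure Ω) (Z : ℕ → Ω → T) : Prop :=
  IdentDistrib (fun ω i => Z (i + 1) ω) (fun ω i => Z i ω) μ μ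

/-- A stationary, irreducible and aperiodic Markov chain on the finite state space `T`. -/
structure IsStationaryAperiodicChain {Ω : Type*} [MeasurableSpace Ω] [MeasurableSpace T]
    (μ : Measure Ω) (Z : ℕ → Ω → T) (P : Matrix T T ℝ) : Prop where
  chain : IsMarkovChain μ Z P
  stationary : IsStationaryProcess μ Z
  irreducible : P.IsIrreducible
  aperiodic : IsAperiodic P

end Chains

/-! ### The optimal alignment score -/

section Score

variable {A : Type*} {n : ℕ}

/-- The score of the alignment `(ρ, τ)` of the two words `x = (z ·).1` and `y = (z ·).2`: the sum of
the scores of the `k` aligned pairs of letters plus `δ` times `n - k`. -/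
def alignmentScore (S : A → A → ℝ≥0) (δ : ℝ) (z : Fin n → A × A) {k : ℕ}
    (ρ τ : Fin k ↪o Fin n) : ℝ :=
  (∑ i, (S (z (ρ i)).1 (z (τ i)).2 : ℝ)) + δ * ((n : ℝ) - k)

/-- The scores of all alignments. -/
def alignmentScores (S : A → A → ℝ≥0) (δ : ℝ) (z : Fin n → A × A) : Set ℝ :=
  {s | ∃ (k : ℕ) (ρ τ : Fin k ↪o Fin n), alignmentScore S δ z ρ τ = s}

/-- The optimal alignment score `L(z)`, the maximum over all alignments. -/
def optScore (S : A → A → ℝ≥0) (δ : ℝ) (z : Fin n → A × A) : ℝ :=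
  sSup (alignmentScores S δ z)

/-- The supremum in the definition of the optimal score is a maximum. -/
theorem isGreatest_optScore (S : A → A → ℝ≥0) (δ : ℝ) (z : Fin n → A × A) :
    IsGreatest (alignmentScores S δ z) (optScore S δ z) := by
  have hfin : (alignmentScores S δ z).Finite := by
    have hsub : alignmentScores S δ z ⊆
        Set.range (fun p : (k : Fin (n + 1)) × ((Fin k ↪o Fin n) × (Fin k ↪o Fin n)) =>
          alignmentScore S δ z p.2.1 p.2.2) := by
      rintro s ⟨k, ρ, τ, rfl⟩
      have hk : k ≤ n := by
        simpa using Fintype.card_le_of_injective ρ ρ.injective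
      exact ⟨⟨⟨k, Nat.lt_succ_of_le hk⟩, ρ, τ⟩, rfl⟩
    have hF : ∀ k : ℕ, Finite (Fin k ↪o Fin n) := fun k =>
      Finite.of_injective (fun f : Fin k ↪o Fin n => (f : Fin k → Fin n)) DFunLike.coe_injective
    exact (Set.finite_range _).subset hsub
  have hne : (alignmentScores S δ z).Nonempty :=
    ⟨_, 0, OrderEmbedding.ofIsEmpty, OrderEmbedding.ofIsEmpty, rfl⟩
  exact ⟨hne.csSup_mem hfin, fun s hs => le_csSup hfin.bddAbove hs⟩

end Score

/-! ### Triplets, the statistics `U` and `V`, and the random transformation -/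

section Triplets

variable {A : Type*} {n : ℕ}

/-- The first, middle and last position of the `i`-th of the `⌊n / 3⌋` disjoint triplets. -/
def firstPos (i : Fin (n / 3)) : Fin n := ⟨3 * i, by omega⟩

/-- See `firstPos`. -/
def midPos (i : Fin (n / 3)) : Fin n := ⟨3 * i + 1, by omega⟩

/-- See `firstPos`. -/
def lastPos (i : Fin (n / 3)) : Fin n := ⟨3 * i + 2, by omega⟩

variable [DecidableEq A]

/-- The indices of the `(a · b)`-triplets of `z`. -/
def triplets (a b : A × A) (z : Fin n → A × A) : Finset (Fin (n / 3)) :=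
  {i | z (firstPos i) = a ∧ z (lastPos i) = b}

/-- `V`: the number of `(a · b)`-triplets. -/
def statV (a b : A × A) (z : Fin n → A × A) : ℕ := (triplets a b z).card

/-- `U`: the number of letters `d` in the middle of the `(a · b)`-triplets. -/
def statU (a b d : A × A) (z : Fin n → A × A) : ℕ :=
  ((triplets a b z).filter fun i => z (midPos i) = d).card

/-- The indices of the `(a · b)`-triplets whose middle letter is not `d`. -/
def freeTriplets (a b d : A × A) (z : Fin n → A × A) : Finset (Fin (n / 3)) :=
  (triplets a b z).filter fun i => z (midPos i) ≠ d

theorem freeTriplets_nonempty {a b d : A × A} {z : Fin n → A × A}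
    (h : statU a b d z < statV a b z) : (freeTriplets a b d z).Nonempty := by
  have h1 := Finset.card_filter_add_card_filter_not (s := triplets a b z)
    (fun i => z (midPos i) = d)
  rw [← Finset.card_pos]
  unfold freeTriplets
  unfold statU statV at h
  simp only [ne_eq]
  omega

/-- The random transformation `R`, given through the law of `R(z)` for each word `z`: if `U < V`, it
chooses uniformly one of the `(a · b)`-triplets without `d` in the middle and changes
its middle letter into `d`; if `U = V`, there is nothing to change and `z` is kept. -/
def randomTransformation (a b d : A × A) (z : Fin n → A × A) : PMF (Fin n → A × A) :=
  if h : statU a b d z < statV a b z then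
    (PMF.uniformOfFinset (freeTriplets a b d z) (freeTriplets_nonempty h)).map
      fun i => Function.update z (midPos i) d
  else PMF.pure z

/-- `E[L(R(Z)) - L(Z) | Z = z]`, the expectation over the randomness of `R`, which is independent
of `Z`. -/
def expectedGain [Fintype A] (S : A → A → ℝ≥0) (δ : ℝ) (a b d : A × A) (z : Fin n → A × A) : ℝ :=
  ∑ w, (randomTransformation a b d z w).toReal * (optScore S δ w - optScore S δ z)

end Triplets

/-- The first `n` letters `(Z 0, …, Z (n - 1))` of the process. -/
def word {A Ω : Type*} (Z : ℕ → Ω → A × A) (n : ℕ) (ω : Ω) : Fin n → A × A := fun i => Z i ω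

/-- The condition A1 with constant `ε` on the random transformation `R` (it increases the score in
mean by at least `ε`, with probability tending to one):
`P(E[L(R(Z)) - L(Z) | Z] ≥ ε) ≥ 1 - Δ n` for some sequence `Δ n → 0`. -/
def AssumptionA1 {A Ω : Type*} [Fintype A] [DecidableEq A] [MeasurableSpace Ω] (μ : Measure Ω)
    (Z : ℕ → Ω → A × A) (S : A → A → ℝ≥0) (δ : ℝ) (a b d : A × A) (ε : ℝ) : Prop :=
  ∃ Δ : ℕ → ℝ, Tendsto Δ atTop (𝓝 0) ∧
    ∀ n, 1 - Δ n ≤ μ.real {ω | ε ≤ expectedGain S δ a b d (word Z n ω)}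

/-- `q`, the conditional probability of `d` in the middle of an `(a · b)`-triplet. -/
def midProb {T : Type*} [Fintype T] (P : Matrix T T ℝ) (a b d : T) : ℝ :=
  P a d * P d b / ∑ d', P a d' * P d' b

/-- `b(q) = √(2πq(1-q)) exp(1/(2q(1-q)))`, for `0 < q < 1`. -/
def bConst (q : ℝ) : ℝ :=
  Real.sqrt (2 * Real.pi * q * (1 - q)) * Real.exp (1 / (2 * q * (1 - q)))

end PairwiseMarkov

end

/-! The transformation moves the law of the word along the levels of `U`. Changing the middle letter
of an `(a · b)`-triplet affects only two transition factors of the path probability, so a double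
count (`sum_level_freeTriplets`) shows that the law given `(U, V) = (u, v)` is carried to the law
given `(u + 1, v)`. Two facts follow. Given `V = v`, the variable `U` is binomial with parameters
`v` and `q` (`levelProb_eq`). The conditional means `l u` of the score satisfy: `l (u + 1) - l u` is
the conditional mean of the expected gain.

By A1 this increment is at least `ε` up to a small error, because on the rare bad words the gain is
still bounded below (`neg_le_expectedGain`). In a window of length `√v` around `v * q` each binomial
probability is at least a constant over `√v` (`le_binomProb`). A function with slope about `ε` can
stay within `ε * √v / 8` of a constant on only about a quarter of this window, so the remaining
levels carry a fixed mass (`le_sum_binomProb_of_slope`). Jensen's inequality on each level passes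
from `l u` back to the score (`le_sum_vLevel`).

It remains to know that `V ≥ α * n / 2` with probability tending to one. This is Chebyshev's
inequality with a variance linear in `n`, obtained from the Poisson equation for the cube of the
transition matrix; no mixing rate is needed. At `v = α * n / 2` the distance `ε * √v / 8` is `ε *
√(2 * α * n) / 16`. -/

set_option linter.unusedSectionVars false

namespace PairwiseMarkov

/-! ### Markov property for events of the past, and stationarity -/

section ChainProbabilities

variable {T Ω : Type*} [Fintype T] [DecidableEq T] [MeasurableSpace T] [MeasurableSingletonClass T]
  [MeasurableSpace Ω] {μ : Measure Ω} [IsProbabilityMeasure μ] {Z : ℕ → Ω → T} {P : Matrix T T ℝ}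

theorem measureReal_eq_sum_inter_fiber {W : Type*} [Fintype W] (f : Ω → W)
    (hf : ∀ w, MeasurableSet (f ⁻¹' {w})) {E : Set Ω} (hE : MeasurableSet E) :
    μ.real E = ∑ w, μ.real (E ∩ f ⁻¹' {w}) := by
  classical
  rw [← measureReal_biUnion_finset]
  · congr 1
    ext ω
    simp
  · intro v _ w _ hvw
    refine Set.disjoint_left.2 fun ω h1 h2 => hvw ?_
    rw [← h1.2, ← h2.2]
  · exact fun w _ => hE.inter (hf w)

/-- The event `E` is determined by the letters up to time `N`. -/
def IsPast (Z : ℕ → Ω → T) (N : ℕ) (E : Set Ω) : Prop :=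
  ∀ ω ω', (∀ i ≤ N, Z i ω = Z i ω') → (ω ∈ E ↔ ω' ∈ E)

theorem IsMarkovChain.measurableSet_eq (hZ : IsMarkovChain μ Z P) (i : ℕ) (x : T) :
    MeasurableSet {ω | Z i ω = x} :=
  hZ.measurable i (measurableSet_singleton x)

/-- The event `E ∩ {Z N = x}` is a union of cylinders over the first `N + 1` letters, and the Markov
property for paths applies to each cylinder. -/
theorem IsMarkovChain.past_step (hZ : IsMarkovChain μ Z P) {N : ℕ} {E : Set Ω}
    (hEm : MeasurableSet E) (hE : IsPast Z N E) (x y : T) :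
    μ.real (E ∩ {ω | Z N ω = x} ∩ {ω | Z (N + 1) ω = y}) =
      μ.real (E ∩ {ω | Z N ω = x}) * P x y := by
  classical
  set f : Ω → (Fin (N + 1) → T) := fun ω i => Z i ω with hf
  have hfm : ∀ w, MeasurableSet (f ⁻¹' {w}) := by
    intro w
    have : Measurable f := measurable_pi_lambda _ fun i => hZ.measurable i
    exact this (measurableSet_singleton w)
  have hEx := hEm.inter (hZ.measurableSet_eq N x)
  rw [measureReal_eq_sum_inter_fiber f hfm (hEx.inter (hZ.measurableSet_eq (N + 1) y)),
    measureReal_eq_sum_inter_fiber f hfm hEx, Finset.sum_mul]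
  refine Finset.sum_congr rfl fun w _ => ?_
  by_cases h : ∃ ω₀ ∈ E, Z N ω₀ = x ∧ f ω₀ = w
  · obtain ⟨ω₀, h₀, hx, rfl⟩ := h
    have hfib : ∀ ω, f ω = f ω₀ ↔ ∀ i ≤ N, Z i ω = Z i ω₀ := by
      intro ω
      refine ⟨fun h i hi => congrFun h ⟨i, Nat.lt_succ_of_le hi⟩, fun h => ?_⟩
      ext i
      exact h i (Nat.le_of_lt_succ i.2)
    have hm := hZ.markov N (fun i => if i ≤ N then Z i ω₀ else y)
    have e1 : E ∩ {ω | Z N ω = x} ∩ {ω | Z (N + 1) ω = y} ∩ f ⁻¹' {f ω₀} =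
        {ω | ∀ i ≤ N + 1, Z i ω = if i ≤ N then Z i ω₀ else y} := by
      ext ω
      simp only [Set.mem_inter_iff, Set.mem_ofPred_eq, Set.mem_preimage, Set.mem_singleton_iff, hfib]
      constructor
      · rintro ⟨⟨_, h2⟩, h3⟩ i hi
        split_ifs with hiN
        · exact h3 i hiN
        · obtain rfl : i = N + 1 := by omega
          exact h2
      · intro h
        have h3 : ∀ i ≤ N, Z i ω = Z i ω₀ := fun i hi => by
          have := h i (by omega)
          rwa [if_pos hi] at this
        refine ⟨⟨⟨(hE ω ω₀ h3).2 h₀, (h3 N le_rfl).trans hx⟩, ?_⟩, h3⟩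
        have := h (N + 1) le_rfl
        rwa [if_neg (by omega)] at this
    have e2 : E ∩ {ω | Z N ω = x} ∩ f ⁻¹' {f ω₀} =
        {ω | ∀ i ≤ N, Z i ω = if i ≤ N then Z i ω₀ else y} := by
      ext ω
      simp only [Set.mem_inter_iff, Set.mem_ofPred_eq, Set.mem_preimage, Set.mem_singleton_iff, hfib]
      constructor
      · rintro ⟨_, h3⟩ i hi
        rw [if_pos hi]
        exact h3 i hi
      · intro h
        have h3 : ∀ i ≤ N, Z i ω = Z i ω₀ := fun i hi => by
          have := h i hi
          rwa [if_pos hi] at this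
        exact ⟨⟨(hE ω ω₀ h3).2 h₀, (h3 N le_rfl).trans hx⟩, h3⟩
    rw [e1, e2, hm]
    simp [hx]
  · have e1 : E ∩ {ω | Z N ω = x} ∩ f ⁻¹' {w} = ∅ := by
      ext ω
      simp only [Set.mem_inter_iff, Set.mem_ofPred_eq, Set.mem_preimage, Set.mem_singleton_iff,
        Set.mem_empty_iff_false, iff_false]
      rintro ⟨⟨h1, h2⟩, h3⟩
      exact h ⟨ω, h1, h2, h3⟩
    have e2 : E ∩ {ω | Z N ω = x} ∩ {ω | Z (N + 1) ω = y} ∩ f ⁻¹' {w} = ∅ := by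
      rw [Set.inter_right_comm, e1, Set.empty_inter]
    rw [e1, e2]
    simp

theorem IsPast.mono {N M : ℕ} (h : N ≤ M) {E : Set Ω} (hE : IsPast Z N E) : IsPast Z M E :=
  fun ω ω' hω => hE ω ω' fun i hi => hω i (hi.trans h)

theorem IsPast.inter {N : ℕ} {E F : Set Ω} (hE : IsPast Z N E) (hF : IsPast Z N F) :
    IsPast Z N (E ∩ F) :=
  fun ω ω' hω => and_congr (hE ω ω' hω) (hF ω ω' hω)

theorem isPast_eq {N i : ℕ} (hi : i ≤ N) (x : T) : IsPast Z N {ω | Z i ω = x} := by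
  intro ω ω' hω
  simp [hω i hi]

theorem isPast_univ (N : ℕ) : IsPast Z N Set.univ := by
  intro ω ω' _
  simp

/-- The Markov property for `k` steps. -/
theorem IsMarkovChain.past_steps (hZ : IsMarkovChain μ Z P) {N : ℕ} {E : Set Ω}
    (hEm : MeasurableSet E) (hE : IsPast Z N E) (x y : T) (k : ℕ) :
    μ.real (E ∩ {ω | Z N ω = x} ∩ {ω | Z (N + k) ω = y}) =
      μ.real (E ∩ {ω | Z N ω = x}) * (P ^ k) x y := by
  have hEx := hEm.inter (hZ.measurableSet_eq N x)
  have hEp := hE.inter (isPast_eq le_rfl x)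
  induction k generalizing y with
  | zero =>
    by_cases h : x = y
    · subst h
      simp [Set.inter_assoc]
    · have : E ∩ {ω | Z N ω = x} ∩ {ω | Z (N + 0) ω = y} = ∅ := by
        ext ω
        simp only [Set.mem_inter_iff, Set.mem_ofPred_eq, add_zero, Set.mem_empty_iff_false, iff_false]
        rintro ⟨⟨_, h2⟩, h3⟩
        exact h (h2.symm.trans h3)
      rw [this]
      simp [h]
  | succ k ih =>
    rw [measureReal_eq_sum_inter_fiber (Z (N + k)) (hZ.measurableSet_eq (N + k))
      (hEx.inter (hZ.measurableSet_eq _ y)), pow_succ, Matrix.mul_apply, Finset.mul_sum]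
    refine Finset.sum_congr rfl fun z _ => ?_
    rw [← mul_assoc, ← ih z, ← hZ.past_step hEx (hEp.mono (Nat.le_add_right N k)) z y,
      Set.inter_right_comm]
    rfl

/-- The probability of a path. -/
theorem IsMarkovChain.measureReal_path (hZ : IsMarkovChain μ Z P) (n : ℕ) (x : ℕ → T) :
    μ.real {ω | ∀ i ≤ n, Z i ω = x i} =
      μ.real {ω | Z 0 ω = x 0} * ∏ i ∈ Finset.range n, P (x i) (x (i + 1)) := by
  induction n with
  | zero => simp
  | succ n ih => rw [hZ.markov, ih, Finset.prod_range_succ, mul_assoc]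

theorem IsStationaryAperiodicChain.measureReal_eq (hZ : IsStationaryAperiodicChain μ Z P)
    (i : ℕ) (x : T) : μ.real {ω | Z i ω = x} = μ.real {ω | Z 0 ω = x} := by
  induction i with
  | zero => rfl
  | succ i ih =>
    have hm : Measurable fun s : ℕ → T => s i := measurable_pi_apply i
    have := hZ.stationary.measure_mem_eq (s := (fun s => s i) ⁻¹' {x})
      (hm (measurableSet_singleton x))
    rw [← ih]
    simp only [measureReal_def]
    congr 1

theorem IsStationaryAperiodicChain.sum_initial_mul (hZ : IsStationaryAperiodicChain μ Z P) (y : T) :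
    ∑ x, μ.real {ω | Z 0 ω = x} * P x y = μ.real {ω | Z 0 ω = y} := by
  rw [← hZ.measureReal_eq 1 y, measureReal_eq_sum_inter_fiber (Z 0)
    (hZ.chain.measurableSet_eq 0) (hZ.chain.measurableSet_eq 1 y)]
  refine Finset.sum_congr rfl fun x _ => ?_
  have := hZ.chain.past_step MeasurableSet.univ (isPast_univ 0) x y
  simp only [Set.univ_inter, zero_add] at this
  rw [← this, Set.inter_comm]
  rfl

theorem IsMarkovChain.sum_initial (hZ : IsMarkovChain μ Z P) :
    ∑ x, μ.real {ω | Z 0 ω = x} = 1 := by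
  have := measureReal_eq_sum_inter_fiber (μ := μ) (Z 0) (hZ.measurableSet_eq 0) MeasurableSet.univ
  simp only [Set.univ_inter, probReal_univ] at this
  exact this.symm

/-- The joint law of two pairs of letters, both at distance two. -/
theorem IsStationaryAperiodicChain.measureReal_pair (hZ : IsStationaryAperiodicChain μ Z P)
    (i : ℕ) (x y : T) :
    μ.real {ω | Z i ω = x ∧ Z (i + 2) ω = y} = μ.real {ω | Z 0 ω = x} * (P ^ 2) x y := by
  have := hZ.chain.past_steps MeasurableSet.univ (isPast_univ i) x y 2
  simp only [Set.univ_inter] at this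
  rw [← hZ.measureReal_eq i x, ← this]
  rfl

/-- The Markov property is used across the first pair, the gap and the second pair. The result
depends only on the gap `k`, which gives the covariances of the triplet indicators. -/
theorem IsStationaryAperiodicChain.measureReal_two_pairs (hZ : IsStationaryAperiodicChain μ Z P)
    (i k : ℕ) (x y : T) :
    μ.real ({ω | Z i ω = x ∧ Z (i + 2) ω = y} ∩
        {ω | Z (i + 2 + k) ω = x ∧ Z (i + 2 + k + 2) ω = y}) =
      μ.real {ω | Z 0 ω = x} * (P ^ 2) x y * ((P ^ k) y x * (P ^ 2) x y) := by
  have hx := hZ.chain.measurableSet_eq i x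
  have h1 := hZ.chain.past_steps hx (isPast_eq (show i ≤ i + 2 by omega) x) y x k
  have h2 := hZ.chain.past_steps (N := i + 2 + k)
    (hx.inter (hZ.chain.measurableSet_eq (i + 2) y))
    ((isPast_eq (show i ≤ i + 2 + k by omega) x).inter
      (isPast_eq (show i + 2 ≤ i + 2 + k by omega) y)) x y 2
  have h3 := hZ.measureReal_pair i x y
  rw [h1] at h2
  rw [← mul_assoc, ← h3]
  refine Eq.trans ?_ h2
  congr 1
  ext ω
  simp only [Set.mem_inter_iff, Set.mem_ofPred_eq]
  tauto

end ChainProbabilities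

end PairwiseMarkov

namespace PairwiseMarkov

/-! ### Irreducibility of the cube and the Poisson equation -/

section Ergodic

variable {T : Type*} [Fintype T] [DecidableEq T] {P Q : Matrix T T ℝ}

theorem pow_apply_pos_add (hP : P ∈ Matrix.rowStochastic ℝ T) {m n : ℕ} {x y z : T}
    (h1 : 0 < (P ^ m) x y) (h2 : 0 < (P ^ n) y z) : 0 < (P ^ (m + n)) x z := by
  have hm := pow_mem hP m
  have hn := pow_mem hP n
  rw [pow_add, Matrix.mul_apply]
  refine (mul_pos h1 h2).trans_le
    (Finset.single_le_sum (f := fun j => (P ^ m) x j * (P ^ n) j z) (fun j _ => ?_)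
      (Finset.mem_univ y))
  exact mul_nonneg (Matrix.nonneg_of_mem_rowStochastic hm) (Matrix.nonneg_of_mem_rowStochastic hn)

/-- The third power of an irreducible and aperiodic stochastic matrix is irreducible. -/
theorem exists_cube_pow_pos (hP : P ∈ Matrix.rowStochastic ℝ T) (hirr : P.IsIrreducible)
    (hap : IsAperiodic P) (x y : T) : ∃ k : ℕ, 0 < ((P ^ 3) ^ k) x y := by
  obtain ⟨j, -, hj⟩ := (Matrix.isIrreducible_iff_exists_pow_pos hirr.nonneg).1 hirr x y
  -- Otherwise 3 would divide all return times to `x`. Preceding the path from `x` to `y` by 0, 1 or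
  -- 2 loops of length `k` then makes its length a multiple of 3.
  obtain ⟨k, -, hk, hk3⟩ : ∃ k : ℕ, 0 < k ∧ 0 < (P ^ k) x x ∧ ¬ 3 ∣ k := by
    by_contra! h
    exact absurd (hap x 3 h) (by norm_num)
  have hrep : ∀ i : ℕ, 0 < (P ^ (i * k + j)) x y := by
    intro i
    induction i with
    | zero => simpa using hj
    | succ i ih =>
      rw [show (i + 1) * k + j = k + (i * k + j) by ring]
      exact pow_apply_pos_add hP hk ih
  obtain ⟨i, l, hil⟩ : ∃ i l : ℕ, i * k + j = 3 * l := by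
    by_cases h0 : j % 3 = 0
    · exact ⟨0, j / 3, by omega⟩
    · by_cases h1 : (k + j) % 3 = 0
      · exact ⟨1, (k + j) / 3, by omega⟩
      · have h2 : (2 * k + j) % 3 = 0 := by
          have h3 : k % 3 ≠ 0 := fun h => hk3 (Nat.dvd_of_mod_eq_zero h)
          have hk' : k % 3 = 1 ∨ k % 3 = 2 := by omega
          rcases hk' with h | h <;> omega
        exact ⟨2, (2 * k + j) / 3, by omega⟩
  refine ⟨l, ?_⟩
  rw [← pow_mul, ← hil]
  exact hrep i

theorem mulVec_pow_eq_self {h : T → ℝ} (hh : Q.mulVec h = h) (k : ℕ) : (Q ^ k).mulVec h = h := by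
  induction k with
  | zero => simp
  | succ k ih => rw [pow_succ, ← Matrix.mulVec_mulVec, hh, ih]

/-- Harmonic functions of an irreducible stochastic matrix are constant. -/
theorem harmonic_eq (hQ : Q ∈ Matrix.rowStochastic ℝ T) (hirr : ∀ x y, ∃ k : ℕ, 0 < (Q ^ k) x y)
    {h : T → ℝ} (hh : Q.mulVec h = h) (x y : T) : h x = h y := by
  obtain ⟨z, -, hz⟩ := Finset.exists_max_image Finset.univ h ⟨x, Finset.mem_univ x⟩
  suffices H : ∀ y, h y = h z by rw [H x, H y]
  intro y
  obtain ⟨k, hk⟩ := hirr z y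
  have hQk := pow_mem hQ k
  -- Maximum principle: the drops from the maximum are nonnegative and average to zero, so they
  -- vanish wherever the weight is positive.
  have h1 : ∑ j, (Q ^ k) z j * (h z - h j) = 0 := by
    have := congrFun (mulVec_pow_eq_self hh k) z
    rw [Matrix.mulVec, dotProduct] at this
    simp only [mul_sub, Finset.sum_sub_distrib, ← Finset.sum_mul,
      Matrix.sum_row_of_mem_rowStochastic hQk, this]
    ring
  have h2 := (Finset.sum_eq_zero_iff_of_nonneg (fun j _ => mul_nonneg
    (Matrix.nonneg_of_mem_rowStochastic hQk) (sub_nonneg.2 (hz j (Finset.mem_univ j))))).1 h1 y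
    (Finset.mem_univ y)
  rcases mul_eq_zero.1 h2 with h3 | h3
  · exact absurd h3 hk.ne'
  · linarith

/-- The Poisson equation of an irreducible stochastic matrix. -/
theorem exists_poisson (hQ : Q ∈ Matrix.rowStochastic ℝ T)
    (hirr : ∀ x y, ∃ k : ℕ, 0 < (Q ^ k) x y) {π : T → ℝ} (hπ : ∀ y, ∑ x, π x * Q x y = π y)
    (hπ1 : ∑ x, π x = 1) {g : T → ℝ} (hg : ∑ x, π x * g x = 0) :
    ∃ h : T → ℝ, h - Q.mulVec h = g := by
  set F : (T → ℝ) →ₗ[ℝ] (T → ℝ) := LinearMap.id - Q.mulVecLin with hF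
  set ℓ : (T → ℝ) →ₗ[ℝ] ℝ := ∑ x, π x • LinearMap.proj x with hℓ
  have hℓa : ∀ f, ℓ f = ∑ x, π x * f x := by
    intro f
    simp [hℓ]
  -- Stationarity gives this inclusion. Equality is a dimension count: the kernel of `F` consists of
  -- constants, so the range has codimension at most one, while `ker ℓ` has codimension exactly one.
  have hle : LinearMap.range F ≤ LinearMap.ker ℓ := by
    rintro _ ⟨h, rfl⟩
    rw [LinearMap.mem_ker, hℓa]
    simp only [hF, LinearMap.sub_apply, LinearMap.id_apply, Matrix.mulVecLin_apply, Pi.sub_apply,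
      mul_sub, Finset.sum_sub_distrib, Matrix.mulVec, dotProduct, Finset.mul_sum]
    rw [Finset.sum_comm, sub_eq_zero]
    refine Finset.sum_congr rfl fun y _ => ?_
    rw [← hπ y, Finset.sum_mul]
    exact Finset.sum_congr rfl fun x _ => by ring
  have hker : Module.finrank ℝ (LinearMap.ker F) ≤ 1 := by
    refine finrank_le_one (⟨fun _ => 1, ?_⟩ : LinearMap.ker F) ?_
    · rw [LinearMap.mem_ker]
      ext x
      simp [hF, Matrix.mulVec, dotProduct, Matrix.sum_row_of_mem_rowStochastic hQ]
    · rintro ⟨h, hh⟩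
      have hh' : Q.mulVec h = h := by
        rw [LinearMap.mem_ker] at hh
        exact (sub_eq_zero.1 hh).symm
      by_cases hT : Nonempty T
      · obtain ⟨x⟩ := hT
        refine ⟨h x, ?_⟩
        ext y
        simpa using harmonic_eq hQ hirr hh' x y
      · refine ⟨0, ?_⟩
        ext y
        exact absurd ⟨y⟩ hT
  have hsurj : LinearMap.range ℓ = ⊤ := by
    rw [LinearMap.range_eq_top]
    intro r
    refine ⟨fun _ => r, ?_⟩
    rw [hℓa, ← Finset.sum_mul, hπ1, one_mul]
  have e1 := LinearMap.finrank_range_add_finrank_ker F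
  have e2 := LinearMap.finrank_range_add_finrank_ker ℓ
  rw [hsurj, finrank_top, Module.finrank_self] at e2
  have heq := Submodule.eq_of_le_of_finrank_le hle (by omega)
  have hgm : g ∈ LinearMap.ker ℓ := by rw [LinearMap.mem_ker, hℓa, hg]
  rw [← heq] at hgm
  obtain ⟨h, hh⟩ := hgm
  exact ⟨h, hh⟩

theorem abs_mulVec_pow_le (hQ : Q ∈ Matrix.rowStochastic ℝ T) {h : T → ℝ} {C : ℝ}
    (hC : ∀ x, |h x| ≤ C) (k : ℕ) (x : T) : |(Q ^ k).mulVec h x| ≤ C := by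
  have hQk := pow_mem hQ k
  rw [Matrix.mulVec, dotProduct]
  calc |∑ j, (Q ^ k) x j * h j| ≤ ∑ j, |(Q ^ k) x j * h j| := Finset.abs_sum_le_sum_abs _ _
    _ ≤ ∑ j, (Q ^ k) x j * C := by
        refine Finset.sum_le_sum fun j _ => ?_
        have := Matrix.nonneg_of_mem_rowStochastic hQk (i := x) (j := j)
        rw [abs_mul, abs_of_nonneg this]
        exact mul_le_mul_of_nonneg_left (hC j) this
    _ = C := by rw [← Finset.sum_mul, Matrix.sum_row_of_mem_rowStochastic hQk, one_mul]

/-- The partial sums of `Q ^ k g` are bounded if `g` is centred under the stationary law. -/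
theorem exists_bound_sum_pow_mulVec (hQ : Q ∈ Matrix.rowStochastic ℝ T)
    (hirr : ∀ x y, ∃ k : ℕ, 0 < (Q ^ k) x y) {π : T → ℝ} (hπ : ∀ y, ∑ x, π x * Q x y = π y)
    (hπ1 : ∑ x, π x = 1) {g : T → ℝ} (hg : ∑ x, π x * g x = 0) :
    ∃ C : ℝ, ∀ (m : ℕ) (x : T), |∑ k ∈ Finset.range m, (Q ^ k).mulVec g x| ≤ C := by
  obtain ⟨h, rfl⟩ := exists_poisson hQ hirr hπ hπ1 hg
  have hC : ∀ x, |h x| ≤ ∑ y, |h y| := fun x =>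
    Finset.single_le_sum (f := fun y => |h y|) (fun y _ => abs_nonneg _) (Finset.mem_univ x)
  refine ⟨2 * ∑ y, |h y|, fun m x => ?_⟩
  -- A solution `h` of the Poisson equation makes the sum telescope.
  have e : ∑ k ∈ Finset.range m, (Q ^ k).mulVec (h - Q.mulVec h) x =
      h x - (Q ^ m).mulVec h x := by
    induction m with
    | zero => simp
    | succ m ih =>
      rw [Finset.sum_range_succ, ih, Matrix.mulVec_sub, Matrix.mulVec_mulVec, ← pow_succ]
      simp
  rw [e]
  refine (abs_sub _ _).trans ?_
  linarith [hC x, abs_mulVec_pow_le hQ hC m x]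

end Ergodic

/-! ### Variance of the number of triplets and Chebyshev's inequality -/

section LawOfLargeNumbers

variable {T Ω : Type*} [Fintype T] [DecidableEq T] [MeasurableSpace T] [MeasurableSingletonClass T]
  [MeasurableSpace Ω] {μ : Measure Ω} [IsProbabilityMeasure μ] {Z : ℕ → Ω → T} {P : Matrix T T ℝ}

/-- The event that the `i`-th triplet is an `(a · b)`-triplet. -/
def tripletEvent (Z : ℕ → Ω → T) (a b : T) (i : ℕ) : Set Ω :=
  {ω | Z (3 * i) ω = a ∧ Z (3 * i + 2) ω = b}

theorem IsMarkovChain.measurableSet_tripletEvent (hZ : IsMarkovChain μ Z P) (a b : T) (i : ℕ) :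
    MeasurableSet (tripletEvent Z a b i) :=
  (hZ.measurableSet_eq _ a).inter (hZ.measurableSet_eq _ b)

/-- The centred indicator of the event that the `i`-th triplet is an `(a · b)`-triplet. -/
noncomputable def tripletDev (μ : Measure Ω) (Z : ℕ → Ω → T) (a b : T) (i : ℕ) (ω : Ω) : ℝ :=
  (tripletEvent Z a b i).indicator 1 ω - μ.real {ω | Z 0 ω = a ∧ Z 2 ω = b}

theorem abs_tripletDev_le (a b : T) (i : ℕ) (ω : Ω) : |tripletDev μ Z a b i ω| ≤ 1 := by
  have h0 : 0 ≤ μ.real {ω | Z 0 ω = a ∧ Z 2 ω = b} := measureReal_nonneg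
  have h1 : μ.real {ω | Z 0 ω = a ∧ Z 2 ω = b} ≤ 1 := measureReal_le_one
  unfold tripletDev Set.indicator
  rw [abs_le]
  split_ifs
  · simp only [Pi.one_apply]
    constructor <;> linarith
  · constructor <;> linarith

theorem IsMarkovChain.measurable_tripletDev (hZ : IsMarkovChain μ Z P) (a b : T) (i : ℕ) :
    Measurable (tripletDev μ Z a b i) :=
  (measurable_one.indicator (hZ.measurableSet_tripletEvent a b i)).sub_const _

theorem IsStationaryAperiodicChain.integral_tripletDev_mul (hZ : IsStationaryAperiodicChain μ Z P)
    (a b : T) (i j : ℕ) :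
    ∫ ω, tripletDev μ Z a b i ω * tripletDev μ Z a b j ω ∂μ =
      μ.real (tripletEvent Z a b i ∩ tripletEvent Z a b j) -
        μ.real {ω | Z 0 ω = a ∧ Z 2 ω = b} ^ 2 := by
  set c := μ.real {ω | Z 0 ω = a ∧ Z 2 ω = b} with hc
  have hev : ∀ i, μ.real (tripletEvent Z a b i) = c := fun i => by
    rw [hc, hZ.measureReal_pair 0, tripletEvent, hZ.measureReal_pair]
  have hm := hZ.chain.measurableSet_tripletEvent a b
  have hint : ∀ s : Set Ω, MeasurableSet s → Integrable (s.indicator (1 : Ω → ℝ)) μ := fun s hs =>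
    (integrable_const (1 : ℝ)).indicator hs
  have e : ∀ ω, tripletDev μ Z a b i ω * tripletDev μ Z a b j ω =
      (tripletEvent Z a b i ∩ tripletEvent Z a b j).indicator 1 ω -
        c * (tripletEvent Z a b i).indicator 1 ω - c * (tripletEvent Z a b j).indicator 1 ω +
        c ^ 2 := by
    intro ω
    rw [Set.inter_indicator_one]
    simp only [tripletDev, ← hc, Pi.mul_apply]
    ring
  simp_rw [e]
  have i1 := hint _ ((hm i).inter (hm j))
  have i2 := (hint _ (hm i)).const_mul c
  have i3 := (hint _ (hm j)).const_mul c
  have i12 : Integrable (fun ω => (tripletEvent Z a b i ∩ tripletEvent Z a b j).indicator 1 ω -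
      c * (tripletEvent Z a b i).indicator 1 ω) μ := i1.sub i2
  have i123 : Integrable (fun ω => (tripletEvent Z a b i ∩ tripletEvent Z a b j).indicator 1 ω -
      c * (tripletEvent Z a b i).indicator 1 ω - c * (tripletEvent Z a b j).indicator 1 ω) μ :=
    i12.sub i3
  rw [integral_add i123 (integrable_const _), integral_sub i12 i3,
    integral_sub i1 i2, integral_const_mul, integral_const_mul, integral_indicator_one (hm i),
    integral_indicator_one (hm j), integral_indicator_one ((hm i).inter (hm j)), hev, hev]
  simp
  ring

/-- The variance of the number of triplets grows at most linearly. -/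
theorem IsStationaryAperiodicChain.exists_variance_triplets_le
    (hZ : IsStationaryAperiodicChain μ Z P) (a b : T) :
    ∃ C : ℝ, 0 ≤ C ∧ ∀ m : ℕ,
      ∫ ω, (∑ i ∈ Finset.range m, tripletDev μ Z a b i ω) ^ 2 ∂μ ≤ C * m := by
  set c := μ.real {ω | Z 0 ω = a ∧ Z 2 ω = b} with hc
  set π : T → ℝ := fun x => μ.real {ω | Z 0 ω = x} with hπ
  have hcπ : c = π a * (P ^ 2) a b := hZ.measureReal_pair 0 a b
  have hst : ∀ (k : ℕ) (y : T), ∑ x, π x * (P ^ k) x y = π y := by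
    intro k
    induction k with
    | zero => simp [Matrix.one_apply]
    | succ k ih =>
      intro y
      have h1 : π y = ∑ x, π x * P x y := (hZ.sum_initial_mul y).symm
      rw [h1]
      simp_rw [pow_succ, Matrix.mul_apply, Finset.mul_sum]
      rw [Finset.sum_comm]
      refine Finset.sum_congr rfl fun z _ => ?_
      rw [← ih z, Finset.sum_mul]
      exact Finset.sum_congr rfl fun x _ => by ring
  -- `f x` is the conditional mean of a centred triplet indicator when the letter just before the
  -- triplet is `x`. That letter ends the preceding triplet, so the covariances are governed by
  -- powers of `P ^ 3`.
  set f : T → ℝ := fun x => P x a * (P ^ 2) a b - c with hf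
  have hPs := hZ.chain.stochastic
  have hf0 : ∑ x, π x * f x = 0 := by
    simp only [hf, mul_sub, Finset.sum_sub_distrib, ← mul_assoc, ← Finset.sum_mul]
    have := hst 1 a
    rw [pow_one] at this
    rw [this, hZ.chain.sum_initial, one_mul, hcπ, sub_self]
  obtain ⟨C, hC⟩ := exists_bound_sum_pow_mulVec (pow_mem hPs 3)
    (exists_cube_pow_pos hPs hZ.irreducible hZ.aperiodic) (hst 3) hZ.chain.sum_initial hf0
  have hC0 : 0 ≤ C := (abs_nonneg _).trans (hC 0 b)
  have hc0 : 0 ≤ c := measureReal_nonneg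
  have hc1 : c ≤ 1 := measureReal_le_one
  have hcross : ∀ j k : ℕ, ∫ ω, tripletDev μ Z a b j ω * tripletDev μ Z a b (j + 1 + k) ω ∂μ =
      c * ((P ^ 3) ^ k).mulVec f b := by
    intro j k
    have h2 := hZ.measureReal_two_pairs (3 * j) (3 * k + 1) a b
    have e1 : 3 * j + 2 + (3 * k + 1) = 3 * (j + 1 + k) := by ring
    rw [e1] at h2
    rw [hZ.integral_tripletDev_mul, tripletEvent, tripletEvent, h2, ← hc]
    have hk := pow_mem (pow_mem hPs 3) k
    have e2 : ((P ^ 3) ^ k).mulVec f b = (P ^ (3 * k + 1)) b a * (P ^ 2) a b - c := by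
      rw [pow_succ _ (3 * k), pow_mul, Matrix.mul_apply]
      simp only [hf, Matrix.mulVec, dotProduct, mul_sub, Finset.sum_sub_distrib, ← mul_assoc,
        ← Finset.sum_mul, Matrix.sum_row_of_mem_rowStochastic hk, one_mul]
    rw [e2, hcπ]
    ring
  have hmeas := hZ.chain.measurable_tripletDev a b
  have hdevint : ∀ i j, Integrable (fun ω => tripletDev μ Z a b i ω * tripletDev μ Z a b j ω) μ := by
    intro i j
    refine Integrable.of_bound ((hmeas i).mul (hmeas j)).aestronglyMeasurable 1 (ae_of_all _ ?_)
    intro ω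
    rw [Real.norm_eq_abs, abs_mul]
    exact mul_le_one₀ (abs_tripletDev_le a b i ω) (abs_nonneg _) (abs_tripletDev_le a b j ω)
  have hsq : ∀ m, Integrable (fun ω => (∑ i ∈ Finset.range m, tripletDev μ Z a b i ω) ^ 2) μ := by
    intro m
    simp_rw [sq, Finset.sum_mul_sum]
    exact integrable_finsetSum _ fun i _ => integrable_finsetSum _ fun j _ => hdevint i j
  -- One more triplet adds twice the sum of its covariances with the earlier ones, at most `2 * C`,
  -- and its own square, at most 1.
  refine ⟨2 * C + 1, by linarith, fun m => ?_⟩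
  induction m with
  | zero => simp
  | succ m ih =>
    have hsum : ∫ ω, ∑ j ∈ Finset.range m, tripletDev μ Z a b j ω * tripletDev μ Z a b m ω ∂μ ≤ C := by
      rw [integral_finsetSum _ fun j _ => hdevint j m]
      have e : ∑ j ∈ Finset.range m, ∫ ω, tripletDev μ Z a b j ω * tripletDev μ Z a b m ω ∂μ =
          c * ∑ k ∈ Finset.range m, ((P ^ 3) ^ k).mulVec f b := by
        rw [Finset.mul_sum, ← Finset.sum_range_reflect]
        refine Finset.sum_congr rfl fun k hk => ?_
        rw [Finset.mem_range] at hk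
        rw [← hcross (m - 1 - k) k]
        congr! 4
        omega
      rw [e]
      calc c * _ ≤ c * C := mul_le_mul_of_nonneg_left ((le_abs_self _).trans (hC m b)) hc0
        _ ≤ C := mul_le_of_le_one_left hC0 hc1
    have hlast : ∫ ω, tripletDev μ Z a b m ω * tripletDev μ Z a b m ω ∂μ ≤ 1 := by
      calc _ ≤ ∫ ω, (1 : ℝ) ∂μ := by
            refine integral_mono (hdevint m m) (integrable_const _) fun ω => ?_
            have := abs_tripletDev_le (μ := μ) (Z := Z) a b m ω
            have h := mul_le_one₀ this (abs_nonneg _) this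
            rwa [abs_mul_abs_self] at h
        _ = 1 := by simp
    have hexp : ∀ ω, (∑ i ∈ Finset.range (m + 1), tripletDev μ Z a b i ω) ^ 2 =
        (∑ i ∈ Finset.range m, tripletDev μ Z a b i ω) ^ 2 +
          2 * ∑ j ∈ Finset.range m, tripletDev μ Z a b j ω * tripletDev μ Z a b m ω +
          tripletDev μ Z a b m ω * tripletDev μ Z a b m ω := by
      intro ω
      rw [Finset.sum_range_succ, ← Finset.sum_mul]
      ring
    have i2 : Integrable (fun ω => 2 * ∑ j ∈ Finset.range m,
        tripletDev μ Z a b j ω * tripletDev μ Z a b m ω) μ :=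
      (integrable_finsetSum _ fun j _ => hdevint j m).const_mul 2
    simp_rw [hexp]
    have i12 : Integrable (fun ω => (∑ i ∈ Finset.range m, tripletDev μ Z a b i ω) ^ 2 +
        2 * ∑ j ∈ Finset.range m, tripletDev μ Z a b j ω * tripletDev μ Z a b m ω) μ :=
      (hsq m).add i2
    rw [integral_add i12 (hdevint m m), integral_add (hsq m) i2, integral_const_mul]
    push_cast
    linarith

end LawOfLargeNumbers

section

variable {A Ω : Type*} [Fintype A] [DecidableEq A] [MeasurableSpace A] [MeasurableSingletonClass A]
  [MeasurableSpace Ω] {μ : Measure Ω} [IsProbabilityMeasure μ] {Z : ℕ → Ω → A × A}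
  {P : Matrix (A × A) (A × A) ℝ}

theorem statV_word (a b : A × A) (n : ℕ) (ω : Ω) :
    (statV a b (word Z n ω) : ℝ) =
      ∑ i ∈ Finset.range (n / 3), (tripletEvent Z a b i).indicator 1 ω := by
  rw [← Fin.sum_univ_eq_sum_range (fun i => (tripletEvent Z a b i).indicator (1 : Ω → ℝ) ω)]
  rw [statV, triplets, Finset.card_filter]
  push_cast
  refine Finset.sum_congr rfl fun i _ => ?_
  simp only [Set.indicator, tripletEvent, Set.mem_ofPred_eq, Pi.one_apply]
  congr 1

theorem IsMarkovChain.measurable_word (hZ : IsMarkovChain μ Z P) (n : ℕ) :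
    Measurable (word Z n) :=
  measurable_pi_lambda _ fun i => hZ.measurable i

/-- There are at least half as many triplets as expected, with probability tending to one. -/
theorem IsStationaryAperiodicChain.tendsto_measureReal_statV_lt
    (hZ : IsStationaryAperiodicChain μ Z P) (a b : A × A) {α : ℝ} (hα0 : 0 < α)
    (hα : α = μ.real {ω | Z 0 ω = a ∧ Z 2 ω = b} / 3) :
    Tendsto (fun n : ℕ => μ.real {ω | (statV a b (word Z n ω) : ℝ) < α * n / 2}) atTop (𝓝 0) := by
  obtain ⟨C, hC0, hC⟩ := hZ.exists_variance_triplets_le a b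
  have hbound : ∀ᶠ n : ℕ in atTop,
      μ.real {ω | (statV a b (word Z n ω) : ℝ) < α * n / 2} ≤ 16 * C / α ^ 2 / n := by
    -- For `n ≥ 8` one has `n - 2 ≥ 3 * n / 4`, so the mean of `V` is at least `3 * α * n / 4` and
    -- `V < α * n / 2` forces a deviation of at least `α * n / 4`.
    filter_upwards [eventually_ge_atTop 8] with n hn
    set f : Ω → ℝ := fun ω => (∑ i ∈ Finset.range (n / 3), tripletDev μ Z a b i ω) ^ 2 with hf
    have hfm : Measurable f :=
      (Finset.measurable_sum _ fun i _ => hZ.chain.measurable_tripletDev a b i).pow_const 2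
    have hfint : Integrable f μ := by
      refine Integrable.of_bound hfm.aestronglyMeasurable ((n / 3 : ℕ) ^ 2 : ℝ) (ae_of_all _ ?_)
      intro ω
      rw [Real.norm_eq_abs, hf, abs_pow]
      gcongr
      refine (Finset.abs_sum_le_sum_abs _ _).trans ?_
      calc _ ≤ ∑ i ∈ Finset.range (n / 3), (1 : ℝ) :=
            Finset.sum_le_sum fun i _ => abs_tripletDev_le a b i ω
        _ = _ := by simp
    have h1 := mul_meas_ge_le_integral_of_nonneg (ae_of_all μ fun ω => sq_nonneg _) hfint
      ((α * n / 4) ^ 2)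
    have hn0 : (8 : ℝ) ≤ n := by exact_mod_cast hn
    have hn3 : (n : ℝ) - 2 ≤ 3 * (n / 3 : ℕ) := by
      have : n ≤ 3 * (n / 3) + 2 := by omega
      have : (n : ℝ) ≤ 3 * (n / 3 : ℕ) + 2 := by exact_mod_cast this
      linarith
    have hn3' : ((n / 3 : ℕ) : ℝ) ≤ n := by exact_mod_cast Nat.div_le_self n 3
    have hsub : {ω | (statV a b (word Z n ω) : ℝ) < α * n / 2} ⊆ {ω | (α * n / 4) ^ 2 ≤ f ω} := by
      intro ω hω
      simp only [Set.mem_ofPred_eq] at hω ⊢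
      have e : ∑ i ∈ Finset.range (n / 3), tripletDev μ Z a b i ω =
          statV a b (word Z n ω) - (n / 3 : ℕ) * (3 * α) := by
        rw [statV_word]
        simp only [tripletDev, Finset.sum_sub_distrib, Finset.sum_const, Finset.card_range,
          nsmul_eq_mul]
        rw [hα]
        ring
      rw [hf]
      simp only
      rw [e]
      have h4 : α * n / 4 ≤ (n / 3 : ℕ) * (3 * α) - statV a b (word Z n ω) := by
        have := mul_le_mul_of_nonneg_left hn3 hα0.le
        have := mul_le_mul_of_nonneg_left hn0 hα0.le
        linarith
      rw [← neg_sub, neg_sq]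
      exact pow_le_pow_left₀ (by positivity) h4 2
    have h2 : μ.real {ω | (statV a b (word Z n ω) : ℝ) < α * n / 2} ≤
        μ.real {ω | (α * n / 4) ^ 2 ≤ f ω} := measureReal_mono hsub
    have hpos : 0 < (α * n / 4) ^ 2 := by positivity
    have h3 : μ.real {ω | (α * n / 4) ^ 2 ≤ f ω} ≤ C * n / (α * n / 4) ^ 2 := by
      rw [le_div_iff₀ hpos, mul_comm]
      exact h1.trans ((hC _).trans (mul_le_mul_of_nonneg_left hn3' hC0))
    refine (h2.trans h3).trans (le_of_eq ?_)
    field_simp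
    norm_num
  refine squeeze_zero' (Eventually.of_forall fun n => measureReal_nonneg) hbound ?_
  exact tendsto_const_div_atTop_nhds_zero_nat _

end

end PairwiseMarkov

namespace PairwiseMarkov

/-! ### Effect of one change on `U`, `V` and the triplets -/

section UpdateMiddle

variable {A : Type*} {n : ℕ} [DecidableEq A]

theorem midPos_injective : Function.Injective (midPos : Fin (n / 3) → Fin n) := by
  intro i j h
  have := congrArg Fin.val h
  simp only [midPos] at this
  exact Fin.ext (by omega)

theorem firstPos_ne_midPos (i j : Fin (n / 3)) : firstPos j ≠ midPos i := by
  intro h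
  have := congrArg Fin.val h
  simp only [midPos, firstPos] at this
  omega

theorem lastPos_ne_midPos (i j : Fin (n / 3)) : lastPos j ≠ midPos i := by
  intro h
  have := congrArg Fin.val h
  simp only [midPos, lastPos] at this
  omega

/-- Triplets are recognised by their end letters, and a middle position is never an end position,
even of another triplet. -/
theorem triplets_update (a b : A × A) (z : Fin n → A × A) (i : Fin (n / 3)) (e : A × A) :
    triplets a b (Function.update z (midPos i) e) = triplets a b z := by
  simp [triplets, Function.update_of_ne (firstPos_ne_midPos i _),
    Function.update_of_ne (lastPos_ne_midPos i _)]

theorem statV_update (a b : A × A) (z : Fin n → A × A) (i : Fin (n / 3)) (e : A × A) :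
    statV a b (Function.update z (midPos i) e) = statV a b z := by
  rw [statV, triplets_update, statV]

theorem update_midPos_apply (z : Fin n → A × A) (i j : Fin (n / 3)) (e : A × A) :
    Function.update z (midPos i) e (midPos j) = if j = i then e else z (midPos j) := by
  by_cases h : j = i
  · subst h
    simp
  · rw [if_neg h, Function.update_of_ne (midPos_injective.ne h)]

/-- The indices of the `(a · b)`-triplets with middle letter `d`. -/
def fullTriplets (a b d : A × A) (z : Fin n → A × A) : Finset (Fin (n / 3)) :=
  (triplets a b z).filter fun i => z (midPos i) = d

theorem card_fullTriplets (a b d : A × A) (z : Fin n → A × A) :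
    (fullTriplets a b d z).card = statU a b d z := rfl

theorem statU_add_card_freeTriplets (a b d : A × A) (z : Fin n → A × A) :
    statU a b d z + (freeTriplets a b d z).card = statV a b z :=
  Finset.card_filter_add_card_filter_not _

theorem statU_le_statV (a b d : A × A) (z : Fin n → A × A) : statU a b d z ≤ statV a b z :=
  Finset.card_filter_le _ _

theorem statU_update_of_free {a b d : A × A} {z : Fin n → A × A} {i : Fin (n / 3)}
    (hi : i ∈ freeTriplets a b d z) :
    statU a b d (Function.update z (midPos i) d) = statU a b d z + 1 := by
  rw [freeTriplets, Finset.mem_filter] at hi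
  have : fullTriplets a b d (Function.update z (midPos i) d) = insert i (fullTriplets a b d z) := by
    ext j
    simp only [fullTriplets, triplets_update, Finset.mem_filter, Finset.mem_insert,
      update_midPos_apply]
    by_cases h : j = i
    · subst h
      simp [hi.1]
    · simp [h]
  rw [← card_fullTriplets, this, Finset.card_insert_of_notMem, card_fullTriplets]
  simp [fullTriplets, hi.2]

theorem statU_update_of_full {a b d e : A × A} (he : e ≠ d) {z : Fin n → A × A} {i : Fin (n / 3)}
    (hi : i ∈ fullTriplets a b d z) :
    statU a b d (Function.update z (midPos i) e) + 1 = statU a b d z := by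
  have : fullTriplets a b d (Function.update z (midPos i) e) = (fullTriplets a b d z).erase i := by
    ext j
    simp only [fullTriplets, triplets_update, Finset.mem_filter, Finset.mem_erase,
      update_midPos_apply]
    by_cases h : j = i
    · subst h
      simp [he]
    · simp [h]
  rw [← card_fullTriplets, this, Finset.card_erase_add_one hi, card_fullTriplets]

end UpdateMiddle

/-! ### The expected gain as an average over the free triplets -/

section ExpectedGain

variable {A : Type*} [Fintype A] [DecidableEq A]

/-- The expected gain is the mean of the gains over all possible changes. -/
theorem expectedGain_of_lt (S : A → A → ℝ≥0) (δ : ℝ) {n : ℕ} {a b d : A × A} {z : Fin n → A × A}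
    (h : statU a b d z < statV a b z) :
    expectedGain S δ a b d z = ((freeTriplets a b d z).card : ℝ)⁻¹ *
      ∑ i ∈ freeTriplets a b d z,
        (optScore S δ (Function.update z (midPos i) d) - optScore S δ z) := by
  classical
  rw [expectedGain, randomTransformation, dif_pos h]
  have h1 : ∀ w, (((PMF.uniformOfFinset (freeTriplets a b d z) (freeTriplets_nonempty h)).map
      fun i => Function.update z (midPos i) d) w).toReal =
      ∑ i ∈ freeTriplets a b d z, if w = Function.update z (midPos i) d then
        ((freeTriplets a b d z).card : ℝ)⁻¹ else 0 := by
    intro w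
    rw [PMF.map_apply, tsum_fintype, ENNReal.toReal_sum, ← Finset.sum_subset
      (Finset.subset_univ (freeTriplets a b d z))]
    · refine Finset.sum_congr rfl fun i hi => ?_
      rw [PMF.uniformOfFinset_apply, if_pos hi]
      split_ifs <;> simp
    · intro i _ hi
      rw [PMF.uniformOfFinset_apply, if_neg hi]
      simp
    · intro i _
      split_ifs
      · exact PMF.apply_ne_top _ _
      · simp
  simp_rw [h1, Finset.sum_mul]
  rw [Finset.sum_comm, Finset.mul_sum]
  refine Finset.sum_congr rfl fun i _ => ?_
  simp

theorem expectedGain_of_eq (S : A → A → ℝ≥0) (δ : ℝ) {n : ℕ} {a b d : A × A} {z : Fin n → A × A}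
    (h : statU a b d z = statV a b z) : expectedGain S δ a b d z = 0 := by
  classical
  rw [expectedGain, randomTransformation, dif_neg h.not_lt]
  refine Finset.sum_eq_zero fun w _ => ?_
  by_cases hw : w = z
  · simp [hw]
  · simp [PMF.pure_apply, hw]

end ExpectedGain

/-! ### Double counting between neighbouring levels of `U` -/

section Swap

variable {A Ω : Type*} [Fintype A] [DecidableEq A] [MeasurableSpace A] [MeasurableSingletonClass A]
  [MeasurableSpace Ω] {μ : Measure Ω} [IsProbabilityMeasure μ] {Z : ℕ → Ω → A × A}
  {P : Matrix (A × A) (A × A) ℝ}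

/-- The probability that the first letters form the word `z`. -/
noncomputable def wordProb {n : ℕ} (μ : Measure Ω) (Z : ℕ → Ω → A × A) (z : Fin n → A × A) : ℝ :=
  μ.real (word Z n ⁻¹' {z})

theorem wordProb_nonneg {n : ℕ} (z : Fin n → A × A) : 0 ≤ wordProb μ Z z := measureReal_nonneg

theorem IsMarkovChain.wordProb_succ (hZ : IsMarkovChain μ Z P) {N : ℕ} (x : ℕ → A × A) :
    wordProb μ Z (fun i : Fin (N + 1) => x i) =
      μ.real {ω | Z 0 ω = x 0} * ∏ i ∈ Finset.range N, P (x i) (x (i + 1)) := by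
  rw [← hZ.measureReal_path, wordProb]
  congr 1
  ext ω
  simp only [Set.mem_preimage, Set.mem_singleton_iff, Set.mem_ofPred_eq]
  constructor
  · intro h i hi
    exact congrFun h ⟨i, Nat.lt_succ_of_le hi⟩
  · intro h
    ext1 i
    exact h i (Nat.le_of_lt_succ i.2)

/-- The effect of a change of one inner letter on the probability of a path. -/
theorem prod_path_update (P : Matrix (A × A) (A × A) ℝ) (x : ℕ → A × A) (k M : ℕ)
    (e : A × A) :
    (∏ i ∈ Finset.range (k + (2 + M)),
        P (Function.update x (k + 1) e i) (Function.update x (k + 1) e (i + 1))) *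
      (P (x k) (x (k + 1)) * P (x (k + 1)) (x (k + 2))) =
    (∏ i ∈ Finset.range (k + (2 + M)), P (x i) (x (i + 1))) *
      (P (x k) e * P e (x (k + 2))) := by
  have hne : ∀ j, j ≠ k + 1 → Function.update x (k + 1) e j = x j := fun j hj =>
    Function.update_of_ne hj _ _
  have h1 : ∏ i ∈ Finset.range k,
      P (Function.update x (k + 1) e i) (Function.update x (k + 1) e (i + 1)) =
      ∏ i ∈ Finset.range k, P (x i) (x (i + 1)) := by
    refine Finset.prod_congr rfl fun i hi => ?_
    rw [Finset.mem_range] at hi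
    rw [hne i (by omega), hne (i + 1) (by omega)]
  have h2 : ∏ i ∈ Finset.range M, P (Function.update x (k + 1) e (k + (2 + i)))
      (Function.update x (k + 1) e (k + (2 + i) + 1)) =
      ∏ i ∈ Finset.range M, P (x (k + (2 + i))) (x (k + (2 + i) + 1)) := by
    refine Finset.prod_congr rfl fun i _ => ?_
    rw [hne _ (by omega), hne _ (by omega)]
  rw [Finset.prod_range_add, Finset.prod_range_add, Finset.prod_range_add, Finset.prod_range_add,
    h1, h2]
  simp only [Finset.prod_range_succ, Finset.prod_range_zero, one_mul, add_zero]
  rw [hne k (by omega), hne (k + 1 + 1) (by omega), Function.update_self]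
  ring

/-- Only the transitions into and out of the middle letter change. The product form avoids dividing
by transition probabilities, which may vanish. -/
theorem IsMarkovChain.wordProb_update (hZ : IsMarkovChain μ Z P) {n : ℕ} {a b : A × A}
    {z : Fin n → A × A} {i : Fin (n / 3)} (hi : i ∈ triplets a b z) (e : A × A) :
    wordProb μ Z (Function.update z (midPos i) e) * (P a (z (midPos i)) * P (z (midPos i)) b) =
      wordProb μ Z z * (P a e * P e b) := by
  obtain ⟨N, M, rfl, hN⟩ : ∃ N M, n = N + 1 ∧ N = 3 * (i : ℕ) + (2 + M) :=
    ⟨n - 1, n - 3 - 3 * i, by have := i.2; omega, by have := i.2; omega⟩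
  -- The value `a` beyond the end of the word only pads the path and is never read.
  set x : ℕ → A × A := fun j => if h : j < N + 1 then z ⟨j, h⟩ else a with hx
  have hxz : ∀ j : Fin (N + 1), x j = z j := fun j => by simp only [hx, dif_pos j.2]
  have hz : z = fun j : Fin (N + 1) => x j := by
    ext1 j
    rw [hxz]
  have hzu : Function.update z (midPos i) e =
      fun j : Fin (N + 1) => Function.update x (3 * i + 1) e j := by
    ext1 j
    by_cases h : j = midPos i
    · subst h
      rw [Function.update_self]
      exact (Function.update_self (3 * (i : ℕ) + 1) e x).symm
    · rw [Function.update_of_ne h, Function.update_of_ne, hxz]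
      intro h'
      exact h (Fin.ext h')
  rw [triplets, Finset.mem_filter] at hi
  obtain ⟨-, ha, hb⟩ := hi
  have ha' : x (3 * i) = a := by rw [← ha, ← hxz]; rfl
  have hb' : x (3 * i + 2) = b := by rw [← hb, ← hxz]; rfl
  have hm' : z (midPos i) = x (3 * i + 1) := by rw [← hxz]; rfl
  have key := prod_path_update P x (3 * i) M e
  rw [← hN, ha', hb'] at key
  rw [hzu, hZ.wordProb_succ, hm', mul_assoc, key, hz, hZ.wordProb_succ,
    Function.update_of_ne (by omega)]
  ring

/-- The words with given values of `U` and `V`. -/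
def level (n : ℕ) (a b d : A × A) (u v : ℕ) : Finset (Fin n → A × A) :=
  {z | statU a b d z = u ∧ statV a b z = v}

theorem mem_level {n : ℕ} {a b d : A × A} {u v : ℕ} {z : Fin n → A × A} :
    z ∈ level n a b d u v ↔ statU a b d z = u ∧ statV a b z = v := by
  simp [level]

/-- Words that differ only in this middle letter have probabilities proportional to `P a e * P e b`,
so the letter `d` has share `q` of their total and the other letters together have share `1 - q`. -/
theorem midProb_mul_sum (hZ : IsMarkovChain μ Z P) {n : ℕ} {a b d : A × A}
    (hq : 0 < midProb P a b d) {z : Fin n → A × A} {i : Fin (n / 3)}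
    (hi : i ∈ fullTriplets a b d z) :
    (1 - midProb P a b d) * wordProb μ Z z = midProb P a b d *
      ∑ e ∈ Finset.univ.erase d, wordProb μ Z (Function.update z (midPos i) e) := by
  rw [fullTriplets, Finset.mem_filter] at hi
  have hnn : ∀ e, 0 ≤ P a e * P e b := fun e => mul_nonneg
    (Matrix.nonneg_of_mem_rowStochastic hZ.stochastic)
    (Matrix.nonneg_of_mem_rowStochastic hZ.stochastic)
  have hG0 : 0 ≤ ∑ e, P a e * P e b := Finset.sum_nonneg fun e _ => hnn e
  rw [midProb] at hq ⊢
  have hG : (∑ e, P a e * P e b) ≠ 0 := by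
    intro h
    rw [h, div_zero] at hq
    exact lt_irrefl _ hq
  have hd : P a d * P d b ≠ 0 := by
    intro h
    rw [h, zero_div] at hq
    exact lt_irrefl _ hq
  have h1 : ∀ e, wordProb μ Z (Function.update z (midPos i) e) =
      wordProb μ Z z * (P a e * P e b) / (P a d * P d b) := by
    intro e
    rw [eq_div_iff hd, ← hZ.wordProb_update hi.1 e, hi.2]
  simp_rw [h1]
  rw [← Finset.sum_div, ← Finset.mul_sum, ← Finset.add_sum_erase _ _ (Finset.mem_univ d)] at *
  set R := ∑ x ∈ Finset.univ.erase d, P a x * P x b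
  set g := P a d * P d b
  field_simp
  ring

/-- Double counting: the law of `Z` given `(U, V) = (u, v)` is transformed by the random
transformation into the law given `(U, V) = (u + 1, v)`. -/
theorem sum_level_freeTriplets (hZ : IsMarkovChain μ Z P) {n : ℕ} {a b d : A × A}
    (hq : 0 < midProb P a b d) (u v : ℕ) (F : (Fin n → A × A) → ℝ) :
    midProb P a b d * ∑ z ∈ level n a b d u v, ∑ i ∈ freeTriplets a b d z,
        wordProb μ Z z * F (Function.update z (midPos i) d) =
      (1 - midProb P a b d) * (u + 1) * ∑ z ∈ level n a b d (u + 1) v, wordProb μ Z z * F z := by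
  have hR : (1 - midProb P a b d) * (u + 1) * ∑ z ∈ level n a b d (u + 1) v, wordProb μ Z z * F z =
      midProb P a b d * ∑ z ∈ level n a b d (u + 1) v, ∑ i ∈ fullTriplets a b d z,
        ∑ e ∈ Finset.univ.erase d, wordProb μ Z (Function.update z (midPos i) e) * F z := by
    rw [Finset.mul_sum, Finset.mul_sum]
    refine Finset.sum_congr rfl fun z hz => ?_
    have h1 : ∀ i ∈ fullTriplets a b d z, midProb P a b d * ∑ e ∈ Finset.univ.erase d,
        wordProb μ Z (Function.update z (midPos i) e) * F z =
        (1 - midProb P a b d) * wordProb μ Z z * F z := by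
      intro i hi
      rw [midProb_mul_sum hZ hq hi, ← Finset.sum_mul, mul_assoc]
    rw [Finset.mul_sum, Finset.sum_congr rfl h1, Finset.sum_const, card_fullTriplets,
      (mem_level.1 hz).1, nsmul_eq_mul]
    push_cast
    ring
  rw [hR]
  congr 1
  simp only [Finset.sum_sigma']
  -- A word with a chosen free triplet corresponds to the changed word with the now full triplet and
  -- the overwritten letter `e ≠ d`, which is what is needed to undo the change.
  refine Finset.sum_bij'
    (fun s _ => ⟨Function.update s.1 (midPos s.2) d, s.2, s.1 (midPos s.2)⟩)
    (fun t _ => ⟨Function.update t.1 (midPos t.2.1) t.2.2, t.2.1⟩) ?_ ?_ ?_ ?_ ?_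
  · rintro ⟨z, i⟩ hs
    simp only [Finset.mem_sigma, mem_level, Finset.mem_erase, Finset.mem_univ, and_true] at hs ⊢
    refine ⟨⟨?_, ?_⟩, ?_, ?_⟩
    · rw [statU_update_of_free hs.2, hs.1.1]
    · rw [statV_update, hs.1.2]
    · have := hs.2
      rw [freeTriplets, Finset.mem_filter] at this
      simp [fullTriplets, triplets_update, this.1]
    · have := hs.2
      rw [freeTriplets, Finset.mem_filter] at this
      exact this.2
  · rintro ⟨z, i, e⟩ ht
    simp only [Finset.mem_sigma, mem_level, Finset.mem_erase, Finset.mem_univ, and_true] at ht ⊢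
    refine ⟨⟨?_, ?_⟩, ?_⟩
    · have := statU_update_of_full ht.2.2 ht.2.1
      omega
    · rw [statV_update, ht.1.2]
    · have := ht.2.1
      rw [fullTriplets, Finset.mem_filter] at this
      simp [freeTriplets, triplets_update, this.1, ht.2.2]
  · rintro ⟨z, i⟩ hs
    simp
  · rintro ⟨z, i, e⟩ ht
    simp only [Finset.mem_sigma, mem_level, Finset.mem_erase, Finset.mem_univ, and_true] at ht
    have := ht.2.1
    rw [fullTriplets, Finset.mem_filter] at this
    simp [← this.2]
  · rintro ⟨z, i⟩ hs
    simp

theorem card_freeTriplets_of_mem_level {n : ℕ} {a b d : A × A} {u v : ℕ} {z : Fin n → A × A}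
    (hz : z ∈ level n a b d u v) : ((freeTriplets a b d z).card : ℝ) = v - u := by
  have := statU_add_card_freeTriplets a b d z
  rw [(mem_level.1 hz).1, (mem_level.1 hz).2] at this
  rw [← this]
  push_cast
  ring

/-- The probability that `(U, V) = (u, v)`. -/
noncomputable def levelProb (n : ℕ) (μ : Measure Ω) (Z : ℕ → Ω → A × A) (a b d : A × A)
    (u v : ℕ) : ℝ :=
  ∑ z ∈ level n a b d u v, wordProb μ Z z

/-- The double count with `F = 1`. This is the recursion of the binomial probabilities in
`binomProb_succ`. -/
theorem levelProb_succ (hZ : IsMarkovChain μ Z P) {a b d : A × A}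
    (hq : 0 < midProb P a b d) (n u v : ℕ) :
    midProb P a b d * ((v - u) * levelProb n μ Z a b d u v) =
      (1 - midProb P a b d) * (u + 1) * levelProb n μ Z a b d (u + 1) v := by
  have := sum_level_freeTriplets (n := n) hZ hq u v (fun _ => 1)
  simp only [mul_one, Finset.sum_const, nsmul_eq_mul] at this
  rw [levelProb, levelProb, ← this, Finset.mul_sum]
  congr 1
  exact Finset.sum_congr rfl fun z hz => by rw [card_freeTriplets_of_mem_level hz]

/-- The double count with `F` the score. Combined with `levelProb_succ`, it identifies the
conditional mean of the gain on a level with the increment of the conditional mean of the score. -/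
theorem sum_level_expectedGain (hZ : IsMarkovChain μ Z P) (S : A → A → ℝ≥0) (δ : ℝ)
    {a b d : A × A} (hq : 0 < midProb P a b d) (n : ℕ) {u v : ℕ} (huv : u < v) :
    midProb P a b d * ((v - u) *
        ∑ z ∈ level n a b d u v, wordProb μ Z z * expectedGain S δ a b d z) =
      (1 - midProb P a b d) * (u + 1) *
        (∑ z ∈ level n a b d (u + 1) v, wordProb μ Z z * optScore S δ z) -
      midProb P a b d * ((v - u) * ∑ z ∈ level n a b d u v, wordProb μ Z z * optScore S δ z) := by
  have huv' : (0 : ℝ) < v - u := sub_pos.2 (by exact_mod_cast huv)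
  rw [← sum_level_freeTriplets hZ hq, ← mul_sub]
  congr 1
  rw [Finset.mul_sum, Finset.mul_sum, ← Finset.sum_sub_distrib]
  refine Finset.sum_congr rfl fun z hz => ?_
  have hl := mem_level.1 hz
  rw [expectedGain_of_lt S δ (by rw [hl.1, hl.2]; exact huv), card_freeTriplets_of_mem_level hz,
    Finset.sum_sub_distrib, Finset.sum_const, nsmul_eq_mul, card_freeTriplets_of_mem_level hz,
    ← Finset.mul_sum]
  field_simp

end Swap

end PairwiseMarkov

namespace PairwiseMarkov

/-! ### Sensitivity of the score to one letter -/

section ScoreChange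

variable {A : Type*} [Fintype A] [DecidableEq A] {n : ℕ}

theorem sum_ite_eq_le_one {k : ℕ} (ρ : Fin k ↪o Fin n) (j : Fin n) :
    ∑ i, (if ρ i = j then (1 : ℝ) else 0) ≤ 1 := by
  rw [Finset.sum_boole]
  have : (Finset.univ.filter fun i => ρ i = j).card ≤ 1 := by
    refine Finset.card_le_one.2 fun x hx y hy => ρ.injective ?_
    rw [(Finset.mem_filter.1 hx).2, (Finset.mem_filter.1 hy).2]
  exact_mod_cast this

/-- The change of one letter decreases the optimal score by at most a constant. -/
theorem optScore_sub_le_update (S : A → A → ℝ≥0) (δ : ℝ) (z : Fin n → A × A) (j : Fin n)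
    (e : A × A) :
    optScore S δ z - 2 * ∑ x, ∑ y, (S x y : ℝ) ≤ optScore S δ (Function.update z j e) := by
  set K := ∑ x, ∑ y, (S x y : ℝ) with hK
  have hSK : ∀ x y, (S x y : ℝ) ≤ K := fun x y =>
    (Finset.single_le_sum (f := fun y => (S x y : ℝ)) (fun _ _ => NNReal.coe_nonneg _)
      (Finset.mem_univ y)).trans
    (Finset.single_le_sum (f := fun x => ∑ y, (S x y : ℝ))
      (fun _ _ => Finset.sum_nonneg fun _ _ => NNReal.coe_nonneg _) (Finset.mem_univ x))
  have hK0 : 0 ≤ K := Finset.sum_nonneg fun _ _ => Finset.sum_nonneg fun _ _ => NNReal.coe_nonneg _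
  obtain ⟨k, ρ, τ, h⟩ := (isGreatest_optScore S δ z).1
  -- An optimal alignment of `z` is kept for the changed word. Each of `ρ` and `τ` meets the
  -- position `j` at most once, and each meeting costs at most `K`.
  refine le_trans ?_ ((isGreatest_optScore S δ (Function.update z j e)).2 ⟨k, ρ, τ, rfl⟩)
  rw [← h, alignmentScore, alignmentScore]
  have hterm : ∀ i, (S (z (ρ i)).1 (z (τ i)).2 : ℝ) ≤
      S (Function.update z j e (ρ i)).1 (Function.update z j e (τ i)).2 +
        (K * (if ρ i = j then (1 : ℝ) else 0) + K * (if τ i = j then (1 : ℝ) else 0)) := by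
    intro i
    have h0 : (0 : ℝ) ≤ S (Function.update z j e (ρ i)).1 (Function.update z j e (τ i)).2 :=
      NNReal.coe_nonneg _
    have h1 := hSK (z (ρ i)).1 (z (τ i)).2
    by_cases hρ : ρ i = j
    · rw [if_pos hρ]
      split_ifs <;> linarith
    · by_cases hτ : τ i = j
      · rw [if_pos hτ, if_neg hρ]
        linarith
      · rw [Function.update_of_ne hρ, Function.update_of_ne hτ, if_neg hρ, if_neg hτ]
        linarith
  have hsum := Finset.sum_le_sum fun i (_ : i ∈ Finset.univ) => hterm i
  rw [Finset.sum_add_distrib, Finset.sum_add_distrib, ← Finset.mul_sum, ← Finset.mul_sum] at hsum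
  have h1 := mul_le_mul_of_nonneg_left (sum_ite_eq_le_one ρ j) hK0
  have h2 := mul_le_mul_of_nonneg_left (sum_ite_eq_le_one τ j) hK0
  linarith

/-- This controls the words on which A1 gives nothing; a bound from below, uniform in `n`, is
enough. -/
theorem neg_le_expectedGain (S : A → A → ℝ≥0) (δ : ℝ) (a b d : A × A) (z : Fin n → A × A) :
    -(2 * ∑ x, ∑ y, (S x y : ℝ)) ≤ expectedGain S δ a b d z := by
  have hK0 : 0 ≤ ∑ x, ∑ y, (S x y : ℝ) :=
    Finset.sum_nonneg fun _ _ => Finset.sum_nonneg fun _ _ => NNReal.coe_nonneg _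
  rcases (statU_le_statV a b d z).lt_or_eq with h | h
  · rw [expectedGain_of_lt S δ h]
    have hc : 0 < ((freeTriplets a b d z).card : ℝ) := by
      exact_mod_cast Finset.card_pos.2 (freeTriplets_nonempty h)
    rw [inv_mul_eq_div, le_div_iff₀ hc, mul_comm, ← nsmul_eq_mul]
    refine Finset.card_nsmul_le_sum _ _ _ fun i _ => ?_
    linarith [optScore_sub_le_update S δ z (midPos i) d]
  · rw [expectedGain_of_eq S δ h]
    linarith

end ScoreChange

end PairwiseMarkov

namespace PairwiseMarkov

/-! ### Local lower bounds for binomial probabilities -/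

section Binomial

/-- The binomial probabilities. -/
noncomputable def binomProb (q : ℝ) (v u : ℕ) : ℝ := v.choose u * q ^ u * (1 - q) ^ (v - u)

variable {q : ℝ} {v : ℕ}

theorem binomProb_pos (h0 : 0 < q) (h1 : q < 1) {u : ℕ} (hu : u ≤ v) : 0 < binomProb q v u := by
  have : 0 < (v.choose u : ℝ) := by exact_mod_cast Nat.choose_pos hu
  have : 0 < 1 - q := by linarith
  unfold binomProb
  positivity

theorem binomProb_nonneg (h0 : 0 < q) (h1 : q < 1) (u : ℕ) : 0 ≤ binomProb q v u := by
  have : 0 < 1 - q := by linarith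
  unfold binomProb
  positivity

theorem binomProb_succ {u : ℕ} (hu : u < v) :
    q * ((v - u) * binomProb q v u) = (1 - q) * (u + 1) * binomProb q v (u + 1) := by
  have h1 : (v.choose (u + 1) : ℝ) * (u + 1) = v.choose u * (v - u) := by
    have := Nat.choose_succ_right_eq v u
    rw [← Nat.cast_sub hu.le]
    exact_mod_cast this
  have h2 : (1 - q) ^ (v - u) = (1 - q) ^ (v - (u + 1)) * (1 - q) := by
    rw [← pow_succ]
    congr 1
    omega
  unfold binomProb
  rw [h2, pow_succ]
  linear_combination (-(q * q ^ u * (1 - q) ^ (v - (u + 1)) * (1 - q))) * h1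

theorem sum_binomProb (q : ℝ) (v : ℕ) : ∑ u ∈ Finset.range (v + 1), binomProb q v u = 1 := by
  have := add_pow q (1 - q) v
  rw [add_sub_cancel, one_pow] at this
  rw [this]
  exact Finset.sum_congr rfl fun u _ => by rw [binomProb]; ring

/-- The variance identity of the Bernstein polynomials, evaluated at `q`. -/
theorem sum_sq_mul_binomProb (q : ℝ) (v : ℕ) :
    ∑ u ∈ Finset.range (v + 1), (v * q - u) ^ 2 * binomProb q v u = v * q * (1 - q) := by
  have := congrArg (Polynomial.eval q) (bernsteinPolynomial.variance ℝ v)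
  simp only [Polynomial.eval_finsetSum, bernsteinPolynomial, Polynomial.eval_mul,
    Polynomial.eval_pow, Polynomial.eval_sub, Polynomial.eval_X, Polynomial.eval_natCast,
    Polynomial.eval_one, nsmul_eq_mul] at this
  rw [← this]
  rfl

theorem card_le_of_abs_sub_lt {s : Finset ℕ} {c r : ℝ} (hr : 0 ≤ r) (hc : 0 ≤ c)
    (hs : ∀ u ∈ s, |(u : ℝ) - c| ≤ r) : (s.card : ℝ) ≤ 2 * r + 1 := by
  have hsub : s ⊆ Finset.Icc ⌈c - r⌉₊ ⌊c + r⌋₊ := by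
    intro u hu
    have := abs_le.1 (hs u hu)
    rw [Finset.mem_Icc]
    exact ⟨Nat.ceil_le.2 (by linarith), Nat.le_floor (by linarith)⟩
  have h1 := Finset.card_le_card hsub
  rw [Nat.card_Icc] at h1
  have h2 : (⌊c + r⌋₊ : ℝ) ≤ c + r := Nat.floor_le (by linarith)
  have h3 : c - r ≤ ⌈c - r⌉₊ := Nat.le_ceil _
  by_cases h : ⌈c - r⌉₊ ≤ ⌊c + r⌋₊ + 1
  · have h4 : (s.card : ℝ) ≤ ((⌊c + r⌋₊ + 1 - ⌈c - r⌉₊ : ℕ) : ℝ) := by exact_mod_cast h1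
    rw [Nat.cast_sub h] at h4
    push_cast at h4
    linarith
  · rw [Nat.sub_eq_zero_of_le (by omega)] at h1
    have : (s.card : ℝ) = 0 := by exact_mod_cast Nat.le_zero.1 h1
    rw [this]
    positivity

/-- The mode of the binomial distribution. -/
noncomputable def binomMode (q : ℝ) (v : ℕ) : ℕ := ⌊(v + 1) * q⌋₊

theorem binomMode_le (h0 : 0 < q) (h1 : q < 1) : binomMode q v ≤ v := by
  rw [← Nat.lt_succ_iff, binomMode, Nat.floor_lt (by positivity)]
  push_cast
  nlinarith [(Nat.cast_nonneg v : (0 : ℝ) ≤ v)]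

/-- The ratio of the probabilities at `u + 1` and `u` is `q * (v - u) / ((1 - q) * (u + 1))`, which
is at least 1 exactly when `u + 1 ≤ (v + 1) * q`. -/
theorem binomProb_le_mode (h0 : 0 < q) (h1 : q < 1) {u : ℕ} (hu : u ≤ v) :
    binomProb q v u ≤ binomProb q v (binomMode q v) := by
  have hk := binomMode_le (v := v) h0 h1
  have hq1 : 0 < 1 - q := by linarith
  rcases le_total u (binomMode q v) with h | h
  · have key : ∀ k, u ≤ k → k ≤ binomMode q v → binomProb q v u ≤ binomProb q v k := by
      intro k huk
      induction k, huk using Nat.le_induction with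
      | base => exact fun _ => le_rfl
      | succ k _ ih =>
        intro hkm
        refine (ih (by omega)).trans ?_
        have hs := binomProb_succ (q := q) (show k < v by omega)
        have h2 : ((k + 1 : ℕ) : ℝ) ≤ (v + 1) * q :=
          (Nat.cast_le.2 hkm).trans (Nat.floor_le (by positivity))
        push_cast at h2
        have h3 : (1 - q) * (k + 1) ≤ q * (v - k) := by linarith
        have h4 : 0 < (1 - q) * ((k : ℝ) + 1) := by positivity
        have h5 := mul_le_mul_of_nonneg_right h3 (binomProb_nonneg (v := v) h0 h1 k)
        rw [mul_assoc q, hs] at h5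
        exact le_of_mul_le_mul_left h5 h4
    exact key _ h le_rfl
  · induction u, h using Nat.le_induction with
    | base => exact le_rfl
    | succ k hk' ih =>
      refine le_trans ?_ (ih (by omega))
      have hs := binomProb_succ (q := q) (show k < v by omega)
      have h2 : (v + 1) * q < k + 1 := by
        have h3 : (v + 1) * q < binomMode q v + 1 := Nat.lt_floor_add_one _
        have h4 : (binomMode q v : ℝ) ≤ k := by exact_mod_cast hk'
        linarith
      have h3 : q * (v - k) ≤ (1 - q) * (k + 1) := by linarith
      have h4 : 0 < (1 - q) * ((k : ℝ) + 1) := by positivity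
      have h5 := mul_le_mul_of_nonneg_right h3 (binomProb_nonneg (v := v) h0 h1 k)
      rw [mul_assoc q, hs] at h5
      exact le_of_mul_le_mul_left h5 h4

/-- A lower bound for the largest binomial probability. -/
theorem le_binomProb_mode (h0 : 0 < q) (h1 : q < 1)
    (hv : 1 ≤ 2 * Real.sqrt (q * (1 - q)) * Real.sqrt v) :
    1 / (8 * Real.sqrt (q * (1 - q)) * Real.sqrt v) ≤ binomProb q v (binomMode q v) := by
  have hq1 : 0 < 1 - q := by linarith
  set σ := Real.sqrt (q * (1 - q)) with hσ
  set s := Real.sqrt v with hs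
  have hσ0 : 0 < σ := Real.sqrt_pos.2 (by positivity)
  have hσ2 : σ ^ 2 = q * (1 - q) := Real.sq_sqrt (by positivity)
  have hs2 : s ^ 2 = v := Real.sq_sqrt (by positivity)
  have hs0 : 0 < s := by
    by_contra h
    have : s = 0 := le_antisymm (not_lt.1 h) (Real.sqrt_nonneg _)
    rw [this] at hv
    linarith
  -- Two standard deviations: by Chebyshev's inequality the window has mass at least 3/4, and it has
  -- at most `4 * σ * s + 1 ≤ 6 * σ * s` points, whence the factor 1/8.
  set I := (Finset.range (v + 1)).filter fun u : ℕ => |(u : ℝ) - v * q| ≤ 2 * σ * s with hI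
  have htail : ∑ u ∈ (Finset.range (v + 1)).filter (fun u : ℕ => ¬ |(u : ℝ) - v * q| ≤ 2 * σ * s),
      binomProb q v u ≤ 1 / 4 := by
    have hpos : 0 < (2 * σ * s) ^ 2 := by positivity
    rw [← mul_le_mul_iff_right₀ hpos, Finset.mul_sum]
    calc _ ≤ ∑ u ∈ (Finset.range (v + 1)).filter
            (fun u : ℕ => ¬ |(u : ℝ) - v * q| ≤ 2 * σ * s), (v * q - u) ^ 2 * binomProb q v u := by
          refine Finset.sum_le_sum fun u hu => ?_
          have h2 := (Finset.mem_filter.1 hu).2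
          refine mul_le_mul_of_nonneg_right ?_ (binomProb_nonneg h0 h1 u)
          rw [← sq_abs (v * q - u), abs_sub_comm]
          exact pow_le_pow_left₀ (by positivity) (not_le.1 h2).le 2
      _ ≤ ∑ u ∈ Finset.range (v + 1), (v * q - u) ^ 2 * binomProb q v u :=
          Finset.sum_le_sum_of_subset_of_nonneg (Finset.filter_subset _ _) fun u _ _ =>
            mul_nonneg (sq_nonneg _) (binomProb_nonneg h0 h1 u)
      _ = v * q * (1 - q) := sum_sq_mul_binomProb q v
      _ = _ := by
          rw [mul_pow, mul_pow, hσ2, hs2]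
          ring
  have hmain : 3 / 4 ≤ ∑ u ∈ I, binomProb q v u := by
    have := Finset.sum_filter_add_sum_filter_not (Finset.range (v + 1))
      (fun u : ℕ => |(u : ℝ) - v * q| ≤ 2 * σ * s) (binomProb q v)
    rw [sum_binomProb] at this
    linarith
  have hcard : (I.card : ℝ) ≤ 2 * (2 * σ * s) + 1 :=
    card_le_of_abs_sub_lt (by positivity) (by positivity) fun u hu => (Finset.mem_filter.1 hu).2
  have hsum : ∑ u ∈ I, binomProb q v u ≤ I.card * binomProb q v (binomMode q v) := by
    rw [← nsmul_eq_mul]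
    refine Finset.sum_le_card_nsmul _ _ _ fun u hu => binomProb_le_mode h0 h1 ?_
    have := (Finset.mem_filter.1 hu).1
    rw [Finset.mem_range] at this
    omega
  have hm0 := binomProb_nonneg (v := v) h0 h1 (binomMode q v)
  have h3 : 3 / 4 ≤ 6 * σ * s * binomProb q v (binomMode q v) :=
    (hmain.trans hsum).trans (mul_le_mul_of_nonneg_right (by linarith) hm0)
  rw [div_le_iff₀ (by positivity)]
  nlinarith

/-- For `0 ≤ y ≤ 1/4` one has `(1 - y) * (1 + 4 / 3 * y) ≥ 1`, hence `1 - y ≥ exp (-(4 / 3 * y))`.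
-/
theorem exp_neg_le_pow {y t : ℝ} {k : ℕ} (hy0 : 0 ≤ y) (hy : y ≤ 1 / 4) (hk : k * (4 / 3 * y) ≤ t) :
    Real.exp (-t) ≤ (1 - y) ^ k := by
  have h1 : Real.exp (-(4 / 3 * y)) ≤ 1 - y := by
    rw [Real.exp_neg, inv_le_comm₀ (Real.exp_pos _) (by linarith)]
    refine le_trans ?_ (Real.add_one_le_exp _)
    rw [inv_le_iff_one_le_mul₀ (by linarith)]
    nlinarith
  calc Real.exp (-t) ≤ Real.exp (k * (-(4 / 3 * y))) := Real.exp_le_exp.2 (by linarith)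
    _ = Real.exp (-(4 / 3 * y)) ^ k := Real.exp_nat_mul _ _
    _ ≤ (1 - y) ^ k := pow_le_pow_left₀ (Real.exp_pos _).le h1 k

/-- A step from `u` to `u + 1` above the mode loses the proportion `(u + 1 - (v + 1) * q) / ((1 - q)
* (u + 1))`. Since `u + 1 ≥ v * q`, this is at most `w / (v * q * (1 - q)) ≤ y`. -/
theorem pow_mul_mode_le_of_ge (h0 : 0 < q) (h1 : q < 1) {y w : ℝ} (hy1 : y ≤ 1)
    (hy : w + 1 ≤ y * (v * (q * (1 - q)))) (hy0 : 0 ≤ y) (k : ℕ)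
    (hk : ((binomMode q v + k : ℕ) : ℝ) - v * q ≤ w) (hkv : binomMode q v + k ≤ v) :
    (1 - y) ^ k * binomProb q v (binomMode q v) ≤ binomProb q v (binomMode q v + k) := by
  have hq1 : 0 < 1 - q := by linarith
  induction k with
  | zero => simp
  | succ k ih =>
    push_cast at hk
    have ih' := ih (by push_cast; linarith) (by omega)
    set u := binomMode q v + k with hu
    have hs := binomProb_succ (q := q) (show u < v by omega)
    have hmode : (v + 1) * q < u + 1 := by
      have h3 : (v + 1) * q < binomMode q v + 1 := Nat.lt_floor_add_one _
      have h4 : (binomMode q v : ℝ) ≤ u := by exact_mod_cast Nat.le_add_right _ _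
      linarith
    have huw : (u : ℝ) + 1 - v * q ≤ w := by
      rw [hu]
      push_cast
      linarith
    have h3 : (1 - y) * ((1 - q) * (u + 1)) ≤ q * (v - u) := by
      have h5 : 0 ≤ y * ((1 - q) * (u + 1 - v * q)) := by
        have : 0 ≤ (u : ℝ) + 1 - v * q := by linarith
        positivity
      nlinarith
    have h4 : 0 < (1 - q) * ((u : ℝ) + 1) := by positivity
    have h5 := mul_le_mul_of_nonneg_right h3 (binomProb_nonneg (v := v) h0 h1 u)
    rw [mul_assoc q, hs] at h5
    have h6 : (1 - y) * binomProb q v u ≤ binomProb q v (u + 1) := by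
      refine le_of_mul_le_mul_left ?_ h4
      linarith
    rw [pow_succ']
    calc _ = (1 - y) * ((1 - y) ^ k * binomProb q v (binomMode q v)) := by ring
      _ ≤ (1 - y) * binomProb q v u := mul_le_mul_of_nonneg_left ih' (by linarith)
      _ ≤ _ := h6

/-- The mirror image below the mode, where `v - u ≥ v * (1 - q)` bounds the denominator. -/
theorem pow_mul_mode_le_of_le (h0 : 0 < q) (h1 : q < 1) {y w : ℝ} (hy1 : y ≤ 1)
    (hy : w + 1 ≤ y * (v * (q * (1 - q)))) (hy0 : 0 ≤ y) (k : ℕ) (hkm : k ≤ binomMode q v)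
    (hk : v * q - ((binomMode q v - k : ℕ) : ℝ) ≤ w) :
    (1 - y) ^ k * binomProb q v (binomMode q v) ≤ binomProb q v (binomMode q v - k) := by
  have hq1 : 0 < 1 - q := by linarith
  have hmv := binomMode_le (v := v) h0 h1
  induction k with
  | zero => simp
  | succ k ih =>
    have hsub : binomMode q v - k = binomMode q v - (k + 1) + 1 := by omega
    have ih' := ih (by omega) (by rw [hsub]; push_cast; linarith)
    rw [hsub] at ih'
    set u := binomMode q v - (k + 1) with hu
    have hs := binomProb_succ (q := q) (show u < v by omega)
    have hmode : (u : ℝ) + 1 ≤ (v + 1) * q := by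
      have h3 : (binomMode q v : ℝ) ≤ (v + 1) * q := Nat.floor_le (by positivity)
      have h4 : ((u + 1 : ℕ) : ℝ) ≤ binomMode q v := by
        rw [Nat.cast_le]
        omega
      push_cast at h4
      linarith
    have huv : (0 : ℝ) < v - u := by
      rw [sub_pos, Nat.cast_lt]
      omega
    have h3 : (1 - y) * (q * (v - u)) ≤ (1 - q) * (u + 1) := by
      have h5 : 0 ≤ y * (q * (v * q - u)) := by
        have : 0 ≤ (v : ℝ) * q - u := by linarith
        positivity
      nlinarith
    have h4 : 0 < q * ((v : ℝ) - u) := by positivity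
    have h5 := mul_le_mul_of_nonneg_right h3 (binomProb_nonneg (v := v) h0 h1 (u + 1))
    rw [← hs] at h5
    have h6 : (1 - y) * binomProb q v (u + 1) ≤ binomProb q v u := by
      refine le_of_mul_le_mul_left ?_ h4
      linarith
    rw [pow_succ']
    calc _ = (1 - y) * ((1 - y) ^ k * binomProb q v (binomMode q v)) := by ring
      _ ≤ (1 - y) * binomProb q v (u + 1) := mul_le_mul_of_nonneg_left ih' (by linarith)
      _ ≤ _ := h6

/-- The constant in the local lower bound `le_binomProb` for binomial probabilities. -/
noncomputable def localConst (q : ℝ) : ℝ :=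
  Real.exp (-(1 / (2 * (q * (1 - q))))) / (8 * Real.sqrt (q * (1 - q)))

theorem localConst_pos (h0 : 0 < q) (h1 : q < 1) : 0 < localConst q := by
  have hq1 : 0 < 1 - q := by linarith
  have : 0 < Real.sqrt (q * (1 - q)) := Real.sqrt_pos.2 (by positivity)
  unfold localConst
  positivity

/-- A local lower bound for binomial probabilities at distance at most `√v / 2` from the mean. -/
theorem le_binomProb (h0 : 0 < q) (h1 : q < 1) (hv : 4 / (q * (1 - q)) ≤ Real.sqrt v) {u : ℕ}
    (hu : |(u : ℝ) - v * q| ≤ Real.sqrt v / 2) :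
    localConst q / Real.sqrt v ≤ binomProb q v u := by
  have hq1 : 0 < 1 - q := by linarith
  set x := q * (1 - q) with hx
  have hx0 : 0 < x := by positivity
  have hx4 : x ≤ 1 / 4 := by nlinarith [sq_nonneg (q - 1 / 2)]
  set s := Real.sqrt v with hs
  have hs2 : s ^ 2 = v := Real.sq_sqrt (by positivity)
  have hsx : 4 ≤ s * x := by rwa [div_le_iff₀ hx0] at hv
  have hs16 : 16 ≤ s := by nlinarith [Real.sqrt_nonneg (v : ℝ)]
  have hs0 : 0 < s := by linarith
  set σ := Real.sqrt x with hσ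
  have hσ2 : σ ^ 2 = x := Real.sq_sqrt hx0.le
  have hσ0 : 0 < σ := Real.sqrt_pos.2 hx0
  have hσ1 : σ ≤ 1 / 2 := by nlinarith
  have hmode := le_binomProb_mode (v := v) h0 h1 (by
    rw [← hx, ← hσ, ← hs]
    nlinarith)
  rw [← hx, ← hσ, ← hs] at hmode
  set y := (s / 2 + 1) / (v * x) with hy
  have hv0 : (0 : ℝ) < v := by rw [← hs2]; positivity
  have hvx : 0 < v * x := by positivity
  have hy0 : 0 ≤ y := by positivity
  have hy4 : y ≤ 1 / 4 := by
    rw [hy, div_le_iff₀ hvx, ← hs2]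
    nlinarith
  have hyw : s / 2 + 1 ≤ y * (v * x) := by rw [hy, div_mul_cancel₀ _ hvx.ne']
  -- The mode is within 1 of the mean, so `s / 2 + 1` steps reach the whole window. The exponent `4
  -- / 3 * (s / 2 + 1) ^ 2 / s ^ 2` stays below 1/2 because `s ≥ 16`.
  have hpow : ∀ k : ℕ, (k : ℝ) ≤ s / 2 + 1 → Real.exp (-(1 / (2 * x))) ≤ (1 - y) ^ k := by
    intro k hk
    refine exp_neg_le_pow hy0 hy4 ?_
    calc k * (4 / 3 * y) ≤ (s / 2 + 1) * (4 / 3 * y) :=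
          mul_le_mul_of_nonneg_right hk (by positivity)
      _ = 4 / 3 * (s / 2 + 1) ^ 2 / s ^ 2 / x := by
          rw [hy, hs2]
          field_simp
      _ ≤ (1 / 2) / x := by
          refine div_le_div_of_nonneg_right ?_ hx0.le
          rw [div_le_iff₀ (by positivity)]
          nlinarith
      _ = 1 / (2 * x) := by field_simp
  have huv : u ≤ v := by
    have h2 := (abs_le.1 hu).2
    have h3 : (u : ℝ) ≤ v := by
      have : s / 2 ≤ v * (1 - q) := by
        rw [← hs2]
        have : x ≤ 1 - q := by nlinarith
        nlinarith
      linarith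
    exact_mod_cast h3
  have hfl : (binomMode q v : ℝ) ≤ (v + 1) * q := Nat.floor_le (by positivity)
  have hfl' : (v + 1) * q < binomMode q v + 1 := Nat.lt_floor_add_one _
  have hfin : ∀ k : ℕ, (k : ℝ) ≤ s / 2 + 1 →
      localConst q / s ≤ (1 - y) ^ k * binomProb q v (binomMode q v) := by
    intro k hk
    calc localConst q / s = Real.exp (-(1 / (2 * x))) * (1 / (8 * σ * s)) := by
          rw [localConst, ← hx, ← hσ]
          field_simp
      _ ≤ _ := mul_le_mul (hpow k hk) hmode (by positivity) (pow_nonneg (by linarith) k)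
  rcases le_total (binomMode q v) u with h | h
  · obtain ⟨k, rfl⟩ := Nat.exists_eq_add_of_le h
    have h2 := (abs_le.1 hu).2
    refine (hfin k ?_).trans (pow_mul_mode_le_of_ge h0 h1 (by linarith) hyw hy0 k h2 huv)
    push_cast at h2
    linarith
  · obtain ⟨k, hk⟩ := Nat.exists_eq_add_of_le h
    have h2 := (abs_le.1 hu).1
    have hku : u = binomMode q v - k := by omega
    have hkR : (binomMode q v : ℝ) = u + k := by exact_mod_cast hk
    have h3 := pow_mul_mode_le_of_le h0 h1 (by linarith) hyw hy0 k (by omega)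
      (by rw [← hku]; linarith)
    rw [← hku] at h3
    exact (hfin k (by linarith)).trans h3

end Binomial

end PairwiseMarkov

namespace PairwiseMarkov

/-! ### Spread of a function with positive slope under the binomial law -/

section Spread

/-- A function that increases with slope at least `ε` up to a small error is far from any constant
with a binomial probability that is bounded from below. -/
theorem le_sum_binomProb_of_slope {q ε K η x m : ℝ} {v : ℕ} {l bad : ℕ → ℝ} (h0 : 0 < q)
    (h1 : q < 1) (hε : 0 < ε) (hK : 0 ≤ K) (hv : 4 / (q * (1 - q)) ≤ Real.sqrt v)
    (hv50 : 50 ≤ Real.sqrt v) (hbad0 : ∀ u, 0 ≤ bad u)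
    (hslope : ∀ u < v, ε - K * bad u ≤ l (u + 1) - l u)
    (hbad : ∑ u ∈ Finset.range (v + 1), binomProb q v u * bad u ≤ η)
    (hη : K * η / localConst q ≤ ε / 100) (hx : x ≤ ε * Real.sqrt v / 8) :
    7 / 10 * localConst q ≤
      ∑ u ∈ (Finset.range (v + 1)).filter (fun u => x ≤ |l u - m|), binomProb q v u := by
  have hβ := localConst_pos h0 h1
  have hq1 : 0 < 1 - q := by linarith
  set β := localConst q with hβdef
  set s := Real.sqrt v with hs
  have hs0 : 0 < s := by linarith
  have hs2 : s ^ 2 = v := Real.sq_sqrt (by positivity)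
  have hsx : 4 ≤ s * (q * (1 - q)) := by rwa [div_le_iff₀ (by positivity)] at hv
  have hcq : s / 2 ≤ v * q := by
    rw [← hs2]
    nlinarith [mul_pos hs0 h0]
  have hcq' : s / 2 ≤ v * (1 - q) := by
    rw [← hs2]
    nlinarith [mul_pos hs0 hq1]
  set I := Finset.Icc ⌈v * q - s / 2⌉₊ ⌊v * q + s / 2⌋₊ with hI
  have hIu : ∀ u ∈ I, |(u : ℝ) - v * q| ≤ s / 2 := by
    intro u hu
    rw [hI, Finset.mem_Icc] at hu
    have e1 := Nat.ceil_le.1 hu.1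
    have e2 := (Nat.le_floor_iff (by positivity)).1 hu.2
    rw [abs_le]
    constructor <;> linarith
  have hIv : ∀ u ∈ I, u ≤ v := by
    intro u hu
    have := (abs_le.1 (hIu u hu)).2
    have h : (u : ℝ) ≤ v := by linarith
    exact_mod_cast h
  have hIsub : I ⊆ Finset.range (v + 1) := fun u hu =>
    Finset.mem_range.2 (Nat.lt_succ_of_le (hIv u hu))
  have hIcard : s - 1 ≤ I.card := by
    have e1 : (⌈v * q - s / 2⌉₊ : ℝ) < v * q - s / 2 + 1 := Nat.ceil_lt_add_one (by linarith)
    have e2 : v * q + s / 2 < ⌊v * q + s / 2⌋₊ + 1 := Nat.lt_floor_add_one _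
    have e3 : ⌊v * q + s / 2⌋₊ + 1 ≤ I.card + ⌈v * q - s / 2⌉₊ := by
      rw [hI, Nat.card_Icc]
      omega
    have e4 : (⌊v * q + s / 2⌋₊ : ℝ) + 1 ≤ I.card + ⌈v * q - s / 2⌉₊ := by exact_mod_cast e3
    linarith
  have hloc : ∀ u ∈ I, β / s ≤ binomProb q v u := fun u hu => le_binomProb h0 h1 hv (hIu u hu)
  -- Each probability in the window is at least `β / s`, so the bound on the binomial mean of `bad`
  -- becomes a bound on its plain sum.
  have hbadI : K * ∑ u ∈ I, bad u ≤ ε * s / 100 := by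
    have e1 : β / s * ∑ u ∈ I, bad u ≤ η := by
      rw [Finset.mul_sum]
      refine le_trans ?_ hbad
      refine (Finset.sum_le_sum fun u hu => mul_le_mul_of_nonneg_right (hloc u hu) (hbad0 u)).trans
        (Finset.sum_le_sum_of_subset_of_nonneg hIsub fun u _ _ =>
          mul_nonneg (binomProb_nonneg h0 h1 u) (hbad0 u))
    have e2 : ∑ u ∈ I, bad u ≤ η * s / β := by
      rw [le_div_iff₀ hβ]
      rw [div_mul_eq_mul_div, div_le_iff₀ hs0] at e1
      linarith
    calc K * ∑ u ∈ I, bad u ≤ K * (η * s / β) := mul_le_mul_of_nonneg_left e2 hK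
      _ = K * η / β * s := by ring
      _ ≤ ε / 100 * s := mul_le_mul_of_nonneg_right hη hs0.le
      _ = _ := by ring
  have htel : ∀ i j, i ≤ j → j ≤ v → ε * ((j : ℝ) - i) - K * ∑ u ∈ Finset.Ico i j, bad u ≤
      l j - l i := by
    intro i j hij
    induction j, hij using Nat.le_induction with
    | base => simp
    | succ j hij ih =>
      intro hjv
      have e1 := ih (by omega)
      have e2 := hslope j (by omega)
      rw [Finset.sum_Ico_succ_top hij]
      push_cast
      linarith
  -- Between two points of `B` the function `l` rises by less than `2 * x ≤ ε * s / 4`, yet by at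
  -- least `ε` times their distance minus `ε * s / 100`. Hence `B` has diameter at most `26 / 100 *
  -- s`.
  set B := I.filter fun u => ¬ x ≤ |l u - m| with hB
  have hBcard : (B.card : ℝ) ≤ 26 / 100 * s + 1 := by
    rcases B.eq_empty_or_nonempty with hBe | hBn
    · rw [hBe, Finset.card_empty, Nat.cast_zero]
      positivity
    · set i := B.min' hBn with hi
      have hiB : i ∈ B := B.min'_mem hBn
      have hdiam : ∀ u ∈ B, |(u : ℝ) - (i + 13 / 100 * s)| ≤ 13 / 100 * s := by
        intro u hu
        have hiu : i ≤ u := B.min'_le u hu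
        obtain ⟨hiI, hix⟩ := Finset.mem_filter.1 hiB
        obtain ⟨huI, hux⟩ := Finset.mem_filter.1 hu
        have e1 := htel i u hiu (hIv u huI)
        have e2 : ∑ w ∈ Finset.Ico i u, bad w ≤ ∑ w ∈ I, bad w := by
          refine Finset.sum_le_sum_of_subset_of_nonneg (fun w hw => ?_) fun w _ _ => hbad0 w
          rw [hI, Finset.mem_Icc] at hiI huI ⊢
          rw [Finset.mem_Ico] at hw
          omega
        have e3 := mul_le_mul_of_nonneg_left e2 hK
        have e4 := abs_lt.1 (not_le.1 hix)
        have e5 := abs_lt.1 (not_le.1 hux)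
        have e6 : ε * ((u : ℝ) - i) ≤ ε * (26 / 100 * s) := by linarith
        have e7 := le_of_mul_le_mul_left e6 hε
        have e8 : (i : ℝ) ≤ u := by exact_mod_cast hiu
        rw [abs_le]
        constructor <;> linarith
      have := card_le_of_abs_sub_lt (by positivity) (by positivity) hdiam
      linarith
  -- At least `(s - 1) - (26 / 100 * s + 1)` points remain, which is at least `7 / 10 * s` because
  -- `s ≥ 50`.
  have hGcard : 7 / 10 * s ≤ ((I.filter fun u => x ≤ |l u - m|).card : ℝ) := by
    have e1 := Finset.card_filter_add_card_filter_not (s := I) (fun u => x ≤ |l u - m|)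
    have e2 : ((I.filter fun u => x ≤ |l u - m|).card : ℝ) + B.card = I.card := by
      exact_mod_cast e1
    linarith
  calc 7 / 10 * β = 7 / 10 * s * (β / s) := by field_simp
    _ ≤ (I.filter fun u => x ≤ |l u - m|).card * (β / s) :=
        mul_le_mul_of_nonneg_right hGcard (by positivity)
    _ ≤ ∑ u ∈ I.filter (fun u => x ≤ |l u - m|), binomProb q v u := by
        rw [← nsmul_eq_mul]
        exact Finset.card_nsmul_le_sum _ _ _ fun u hu => hloc u (Finset.mem_filter.1 hu).1
    _ ≤ _ := Finset.sum_le_sum_of_subset_of_nonneg (Finset.filter_subset_filter _ hIsub)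
        fun u _ _ => binomProb_nonneg h0 h1 u

/-- Jensen's inequality for `Φ |X - m|` and a finite measure of finite support. -/
theorem jensen_abs_sub {ι : Type*} (s : Finset ι) (W L : ι → ℝ) (hW : ∀ i ∈ s, 0 ≤ W i)
    (hpos : 0 < ∑ i ∈ s, W i) {Φ : ℝ → ℝ} (hΦ : ConvexOn ℝ (Set.Ici 0) Φ)
    (hmono : MonotoneOn Φ (Set.Ici 0)) (m : ℝ) :
    (∑ i ∈ s, W i) * Φ |(∑ i ∈ s, W i * L i) / (∑ i ∈ s, W i) - m| ≤
      ∑ i ∈ s, W i * Φ |L i - m| := by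
  set M := ∑ i ∈ s, W i with hM
  have h1 : ∑ i ∈ s, W i / M = 1 := by rw [← Finset.sum_div, div_self hpos.ne']
  have h2 := hΦ.map_sum_le (t := s) (w := fun i => W i / M) (p := fun i => |L i - m|)
    (fun i hi => div_nonneg (hW i hi) hpos.le) h1 (fun i _ => Set.mem_Ici.2 (abs_nonneg _))
  simp only [smul_eq_mul] at h2
  have h3 : |(∑ i ∈ s, W i * L i) / M - m| ≤ ∑ i ∈ s, W i / M * |L i - m| := by
    have e : (∑ i ∈ s, W i * L i) / M - m = ∑ i ∈ s, W i / M * (L i - m) := by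
      simp_rw [mul_sub]
      rw [Finset.sum_sub_distrib, ← Finset.sum_mul, h1, one_mul, Finset.sum_div]
      congr 1
      exact Finset.sum_congr rfl fun i _ => by ring
    rw [e]
    refine (Finset.abs_sum_le_sum_abs _ _).trans (Finset.sum_le_sum fun i hi => ?_)
    rw [abs_mul, abs_of_nonneg (div_nonneg (hW i hi) hpos.le)]
  have h4 := (hmono (Set.mem_Ici.2 (abs_nonneg _)) (Set.mem_Ici.2 ((abs_nonneg _).trans h3)) h3).trans h2
  calc _ ≤ M * ∑ i ∈ s, W i / M * Φ |L i - m| := mul_le_mul_of_nonneg_left h4 hpos.le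
    _ = _ := by
      rw [Finset.mul_sum]
      refine Finset.sum_congr rfl fun i _ => ?_
      field_simp

end Spread

/-! ### Conditioning on `V`: binomial law of `U` and the moment bound -/

section Levels

variable {A Ω : Type*} [Fintype A] [DecidableEq A] [MeasurableSpace A] [MeasurableSingletonClass A]
  [MeasurableSpace Ω] {μ : Measure Ω} [IsProbabilityMeasure μ] {Z : ℕ → Ω → A × A}
  {P : Matrix (A × A) (A × A) ℝ}

/-- The words with `V = v`. -/
def vLevel (n : ℕ) (a b : A × A) (v : ℕ) : Finset (Fin n → A × A) := {z | statV a b z = v}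

theorem sum_vLevel (n : ℕ) (a b d : A × A) (v : ℕ) (f : (Fin n → A × A) → ℝ) :
    ∑ z ∈ vLevel n a b v, f z = ∑ u ∈ Finset.range (v + 1), ∑ z ∈ level n a b d u v, f z := by
  rw [← Finset.sum_fiberwise_of_maps_to (s := vLevel n a b v) (t := Finset.range (v + 1))
    (g := fun z => statU a b d z)]
  · refine Finset.sum_congr rfl fun u _ => Finset.sum_congr ?_ fun _ _ => rfl
    ext z
    simp [vLevel, level, and_comm]
  · intro z hz
    rw [vLevel, Finset.mem_filter] at hz
    rw [Finset.mem_range, ← hz.2]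
    exact Nat.lt_succ_of_le (statU_le_statV a b d z)

/-- The conditional law of `U` given `V = v` is the binomial law. -/
theorem levelProb_eq (hZ : IsMarkovChain μ Z P) {a b d : A × A} (h0 : 0 < midProb P a b d)
    (h1 : midProb P a b d < 1) (n : ℕ) {u v : ℕ} (hu : u ≤ v) :
    levelProb n μ Z a b d u v =
      (∑ z ∈ vLevel n a b v, wordProb μ Z z) * binomProb (midProb P a b d) v u := by
  set q := midProb P a b d with hq
  have hq1 : 0 < 1 - q := by linarith
  -- Both sides satisfy the same first-order recursion, so they are proportional; summation over `u`
  -- then identifies the factor.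
  have key : ∀ u ≤ v, levelProb n μ Z a b d u v =
      levelProb n μ Z a b d 0 v / binomProb q v 0 * binomProb q v u := by
    intro u
    induction u with
    | zero =>
      intro _
      rw [div_mul_cancel₀ _ (binomProb_pos h0 h1 (Nat.zero_le v)).ne']
    | succ u ih =>
      intro hu
      have e1 := levelProb_succ hZ h0 n u v
      rw [← hq, ih (by omega)] at e1
      have e2 := binomProb_succ (q := q) (show u < v by omega)
      have e3 : (1 - q) * ((u : ℝ) + 1) ≠ 0 := by positivity
      refine mul_left_cancel₀ e3 ?_
      rw [← e1]
      linear_combination (levelProb n μ Z a b d 0 v / binomProb q v 0) * e2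
  have hsum : ∑ z ∈ vLevel n a b v, wordProb μ Z z =
      levelProb n μ Z a b d 0 v / binomProb q v 0 := by
    rw [sum_vLevel n a b d v]
    calc _ = ∑ u ∈ Finset.range (v + 1), levelProb n μ Z a b d 0 v / binomProb q v 0 *
          binomProb q v u := Finset.sum_congr rfl fun u hu =>
            key u (Nat.le_of_lt_succ (Finset.mem_range.1 hu))
      _ = _ := by rw [← Finset.mul_sum, sum_binomProb, mul_one]
  rw [hsum, key u hu]

/-- The bound for `Φ |L - m|` on the event `V = v`. -/
theorem le_sum_vLevel (hZ : IsMarkovChain μ Z P) (S : A → A → ℝ≥0) (δ : ℝ) {a b d : A × A}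
    {q : ℝ} (hq : q = midProb P a b d) (h0 : 0 < q) (h1 : q < 1) {ε η x : ℝ} (hε : 0 < ε)
    (hη : (2 * ∑ x, ∑ y, (S x y : ℝ) + ε) * η / localConst q ≤ ε / 100) {v : ℕ}
    (hv : 4 / (q * (1 - q)) ≤ Real.sqrt v) (hv50 : 50 ≤ Real.sqrt v) (hx0 : 0 ≤ x)
    (hx : x ≤ ε * Real.sqrt v / 8) (n : ℕ)
    (hbad : ∑ z ∈ vLevel n a b v, wordProb μ Z z *
      (if expectedGain S δ a b d z < ε then 1 else 0) ≤ η * ∑ z ∈ vLevel n a b v, wordProb μ Z z)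
    {Φ : ℝ → ℝ} (hΦ : ConvexOn ℝ (Set.Ici 0) Φ)
    (hmono : MonotoneOn Φ (Set.Ici 0)) (hΦ0 : ∀ x, 0 ≤ x → 0 ≤ Φ x) (m : ℝ) :
    7 / 10 * localConst q * Φ x * ∑ z ∈ vLevel n a b v, wordProb μ Z z ≤
      ∑ z ∈ vLevel n a b v, wordProb μ Z z * Φ |optScore S δ z - m| := by
  have hW : ∀ z : Fin n → A × A, 0 ≤ wordProb μ Z z := wordProb_nonneg
  set p := ∑ z ∈ vLevel n a b v, wordProb μ Z z with hp
  have hp0 : 0 ≤ p := Finset.sum_nonneg fun z _ => hW z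
  have hq1 : 0 < 1 - q := by linarith
  rcases hp0.eq_or_lt with hp0' | hpos
  · rw [← hp0', mul_zero]
    exact Finset.sum_nonneg fun z _ => mul_nonneg (hW z) (hΦ0 _ (abs_nonneg _))
  set K := 2 * ∑ x, ∑ y, (S x y : ℝ) with hK
  have hK0 : 0 ≤ K := mul_nonneg zero_le_two <|
    Finset.sum_nonneg fun _ _ => Finset.sum_nonneg fun _ _ => NNReal.coe_nonneg _
  set M : ℕ → ℝ := fun u => ∑ z ∈ level n a b d u v, wordProb μ Z z with hM
  have hMeq : ∀ u ≤ v, M u = p * binomProb q v u := fun u hu => by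
    rw [hq] at h0 h1 ⊢
    exact levelProb_eq hZ h0 h1 n hu
  have hMpos : ∀ u ≤ v, 0 < M u := fun u hu => by
    rw [hMeq u hu]
    exact mul_pos hpos (binomProb_pos h0 h1 hu)
  set g : (Fin n → A × A) → ℝ := fun z => if expectedGain S δ a b d z < ε then 1 else 0 with hg
  have hg0 : ∀ z, 0 ≤ g z := fun z => by
    simp only [hg]
    split_ifs <;> norm_num
  set l : ℕ → ℝ := fun u => (∑ z ∈ level n a b d u v, wordProb μ Z z * optScore S δ z) / M u
    with hl
  set bad : ℕ → ℝ := fun u => (∑ z ∈ level n a b d u v, wordProb μ Z z * g z) / M u with hbd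
  have hM0 : ∀ u, 0 ≤ M u := fun u => Finset.sum_nonneg fun z _ => hW z
  -- Pointwise the gain is at least `ε - (K + ε) * g`: at least `ε` on good words and at least `-K`
  -- on bad ones.
  have hslope : ∀ u < v, ε - (K + ε) * bad u ≤ l (u + 1) - l u := by
    intro u hu
    have e1 := sum_level_expectedGain hZ S δ (hq ▸ h0) n hu
    have e2 := levelProb_succ hZ (hq ▸ h0) n u v
    rw [← hq] at e1 e2
    change q * ((v - u) * M u) = (1 - q) * (u + 1) * M (u + 1) at e2
    have hmu := hMpos u hu.le
    have hmu' := hMpos (u + 1) hu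
    have huv : (0 : ℝ) < v - u := sub_pos.2 (by exact_mod_cast hu)
    have e3 : ∑ z ∈ level n a b d (u + 1) v, wordProb μ Z z * optScore S δ z =
        l (u + 1) * M (u + 1) := (div_mul_cancel₀ _ hmu'.ne').symm
    have e4 : ∑ z ∈ level n a b d u v, wordProb μ Z z * optScore S δ z = l u * M u :=
      (div_mul_cancel₀ _ hmu.ne').symm
    have e5 : ∑ z ∈ level n a b d u v, wordProb μ Z z * expectedGain S δ a b d z =
        M u * (l (u + 1) - l u) := by
      rw [e3, e4] at e1
      have : q * (v - u) ≠ 0 := by positivity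
      refine mul_left_cancel₀ this ?_
      linear_combination e1 - l (u + 1) * e2
    have e6 : M u * (ε - (K + ε) * bad u) ≤ M u * (l (u + 1) - l u) := by
      rw [← e5]
      have : M u * (ε - (K + ε) * bad u) =
          ∑ z ∈ level n a b d u v, wordProb μ Z z * (ε - (K + ε) * g z) := by
        have hb : bad u * M u = ∑ z ∈ level n a b d u v, wordProb μ Z z * g z :=
          div_mul_cancel₀ _ hmu.ne'
        simp_rw [mul_sub]
        rw [Finset.sum_sub_distrib, ← Finset.sum_mul]
        simp_rw [mul_left_comm _ (K + ε)]
        rw [← Finset.mul_sum, ← hb]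
        ring
      rw [this]
      refine Finset.sum_le_sum fun z _ => mul_le_mul_of_nonneg_left ?_ (hW z)
      have hz := neg_le_expectedGain S δ a b d z
      simp only [hg]
      split_ifs with h
      · linarith
      · linarith
    exact le_of_mul_le_mul_left e6 hmu
  have hbad' : ∑ u ∈ Finset.range (v + 1), binomProb q v u * bad u ≤ η := by
    refine le_of_mul_le_mul_left ?_ hpos
    rw [Finset.mul_sum, mul_comm p η]
    refine le_trans (le_of_eq ?_) hbad
    rw [sum_vLevel n a b d v]
    refine Finset.sum_congr rfl fun u hu => ?_
    have hu' := Nat.le_of_lt_succ (Finset.mem_range.1 hu)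
    rw [← mul_assoc, ← hMeq u hu', mul_comm]
    exact div_mul_cancel₀ _ (hMpos u hu').ne'
  have hspread := le_sum_binomProb_of_slope (m := m) h0 h1 hε (by linarith : 0 ≤ K + ε) hv hv50
    (fun u => div_nonneg (Finset.sum_nonneg fun z _ => mul_nonneg (hW z) (hg0 z)) (hM0 u))
    hslope hbad' hη hx
  have hΦx := hΦ0 x hx0
  calc 7 / 10 * localConst q * Φ x * p = 7 / 10 * localConst q * (Φ x * p) := by ring
    _ ≤ (∑ u ∈ (Finset.range (v + 1)).filter (fun u => x ≤ |l u - m|), binomProb q v u) *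
          (Φ x * p) := mul_le_mul_of_nonneg_right hspread (mul_nonneg hΦx hp0)
    _ = ∑ u ∈ (Finset.range (v + 1)).filter (fun u => x ≤ |l u - m|), M u * Φ x := by
        rw [Finset.sum_mul]
        refine Finset.sum_congr rfl fun u hu => ?_
        rw [hMeq u (Nat.le_of_lt_succ (Finset.mem_range.1 (Finset.mem_filter.1 hu).1))]
        ring
    _ ≤ ∑ u ∈ (Finset.range (v + 1)).filter (fun u => x ≤ |l u - m|), M u * Φ |l u - m| := by
        refine Finset.sum_le_sum fun u hu => mul_le_mul_of_nonneg_left ?_ (hM0 u)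
        exact hmono (Set.mem_Ici.2 hx0) (Set.mem_Ici.2 (abs_nonneg _)) (Finset.mem_filter.1 hu).2
    _ ≤ ∑ u ∈ Finset.range (v + 1), M u * Φ |l u - m| :=
        Finset.sum_le_sum_of_subset_of_nonneg (Finset.filter_subset _ _) fun u _ _ =>
          mul_nonneg (hM0 u) (hΦ0 _ (abs_nonneg _))
    _ ≤ ∑ u ∈ Finset.range (v + 1), ∑ z ∈ level n a b d u v,
          wordProb μ Z z * Φ |optScore S δ z - m| := by
        refine Finset.sum_le_sum fun u hu => ?_
        exact jensen_abs_sub _ _ _ (fun z _ => hW z)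
          (hMpos u (Nat.le_of_lt_succ (Finset.mem_range.1 hu))) hΦ hmono m
    _ = _ := (sum_vLevel n a b d v _).symm

end Levels

end PairwiseMarkov

namespace PairwiseMarkov

/-! ### Integration over `V` and comparison of constants -/

section LowerBound

variable {A Ω : Type*} [Fintype A] [DecidableEq A] [MeasurableSpace A] [MeasurableSingletonClass A]
  [MeasurableSpace Ω] {μ : Measure Ω} [IsProbabilityMeasure μ] {Z : ℕ → Ω → A × A}
  {P : Matrix (A × A) (A × A) ℝ}

theorem IsMarkovChain.measurableSet_word (hZ : IsMarkovChain μ Z P) {n : ℕ}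
    (s : Set (Fin n → A × A)) : MeasurableSet (word Z n ⁻¹' s) :=
  hZ.measurable_word n s.toFinite.measurableSet

theorem IsMarkovChain.integral_word (hZ : IsMarkovChain μ Z P) (n : ℕ)
    (F : (Fin n → A × A) → ℝ) :
    ∫ ω, F (word Z n ω) ∂μ = ∑ z, wordProb μ Z z * F z := by
  have e : ∀ ω, F (word Z n ω) = ∑ z, (word Z n ⁻¹' {z}).indicator (fun _ => F z) ω := by
    intro ω
    rw [Finset.sum_eq_single (word Z n ω)]
    · simp
    · intro z _ hz
      refine Set.indicator_of_notMem (fun h => hz ?_) _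
      exact (Set.mem_singleton_iff.1 h).symm
    · simp
  simp_rw [e]
  rw [integral_finsetSum]
  · refine Finset.sum_congr rfl fun z _ => ?_
    rw [integral_indicator_const _ (hZ.measurableSet_word {z}), smul_eq_mul, wordProb]
  · exact fun z _ => (integrable_const _).indicator (hZ.measurableSet_word {z})

theorem IsMarkovChain.measureReal_word (hZ : IsMarkovChain μ Z P) (n : ℕ)
    (p : (Fin n → A × A) → Prop) [DecidablePred p] :
    μ.real {ω | p (word Z n ω)} = ∑ z, wordProb μ Z z * (if p z then 1 else 0) := by
  rw [← hZ.integral_word n fun z => if p z then 1 else 0]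
  refine (integral_indicator_one (μ := μ) (hZ.measurableSet_word {z | p z})).symm.trans ?_
  refine integral_congr_ae (ae_of_all _ fun ω => ?_)
  simp [Set.indicator]

theorem IsMarkovChain.sum_wordProb (hZ : IsMarkovChain μ Z P) (n : ℕ) :
    ∑ z : Fin n → A × A, wordProb μ Z z = 1 := by
  have := hZ.integral_word n fun _ => 1
  simpa using this.symm

theorem IsMarkovChain.midProb_le_one (hZ : IsMarkovChain μ Z P) (a b d : A × A) :
    midProb P a b d ≤ 1 := by
  have hnn : ∀ e, 0 ≤ P a e * P e b := fun e => mul_nonneg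
    (Matrix.nonneg_of_mem_rowStochastic hZ.stochastic)
    (Matrix.nonneg_of_mem_rowStochastic hZ.stochastic)
  exact div_le_one_of_le₀ (Finset.single_le_sum (f := fun e => P a e * P e b)
    (fun e _ => hnn e) (Finset.mem_univ d)) (Finset.sum_nonneg fun e _ => hnn e)

/-- The condition A1 excludes that the middle letter is always `d`. -/
theorem AssumptionA1.midProb_lt_one {S : A → A → ℝ≥0} {δ ε : ℝ} {a b d : A × A}
    (hA : AssumptionA1 μ Z S δ a b d ε) (hZ : IsMarkovChain μ Z P) (hε : 0 < ε) :
    midProb P a b d < 1 := by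
  classical
  refine (hZ.midProb_le_one a b d).lt_of_ne fun hq => ?_
  obtain ⟨Δ, hΔ, hn⟩ := hA
  have h1 : ∀ n, 1 ≤ Δ n := by
    intro n
    have := hn n
    rw [hZ.measureReal_word n fun z => ε ≤ expectedGain S δ a b d z, Finset.sum_eq_zero] at this
    · linarith
    intro z _
    split_ifs with h
    · rw [mul_one]
      have hlt : statU a b d z < statV a b z := by
        refine (statU_le_statV a b d z).lt_of_ne fun h' => ?_
        rw [expectedGain_of_eq S δ h'] at h
        linarith
      -- For `q = 1` the recursion gives mass zero to every level with `u < v`. The gain then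
      -- vanishes almost surely, and A1 would force `Δ n ≥ 1`.
      have hs := levelProb_succ hZ (by rw [hq]; exact one_pos) n (statU a b d z) (statV a b z)
        (a := a) (b := b) (d := d)
      rw [hq, one_mul, sub_self, zero_mul, zero_mul] at hs
      have hne : (statV a b z : ℝ) - statU a b d z ≠ 0 := by
        rw [sub_ne_zero]
        exact_mod_cast hlt.ne'
      have h0 := (mul_eq_zero.1 hs).resolve_left hne
      exact (Finset.sum_eq_zero_iff_of_nonneg fun w _ => wordProb_nonneg w).1 h0 z
        (mem_level.2 ⟨rfl, rfl⟩)
    · rw [mul_zero]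
  exact absurd (ge_of_tendsto' hΔ h1) (by norm_num)

theorem sum_eq_sum_vLevel (n : ℕ) (a b : A × A) (f : (Fin n → A × A) → ℝ) :
    ∑ z, f z = ∑ v ∈ Finset.range (n + 1), ∑ z ∈ vLevel n a b v, f z := by
  rw [← Finset.sum_fiberwise_of_maps_to (s := Finset.univ) (t := Finset.range (n + 1))
    (g := fun z => statV a b z)]
  · rfl
  · intro z _
    rw [Finset.mem_range, Nat.lt_succ_iff]
    refine (Finset.card_le_univ _).trans ?_
    rw [Fintype.card_fin]
    exact Nat.div_le_self n 3

/-- The lower bound for the moments with an explicit constant. -/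
theorem IsStationaryAperiodicChain.eventually_le_integral
    (hZ : IsStationaryAperiodicChain μ Z P) (S : A → A → ℝ≥0) (δ : ℝ) {a b d : A × A}
    {q : ℝ} (hq : q = midProb P a b d) (h0 : 0 < q) (h1 : q < 1) {α : ℝ} (hα0 : 0 < α)
    (hα : α = μ.real {ω | Z 0 ω = a ∧ Z 2 ω = b} / 3) {ε : ℝ} (hε : 0 < ε)
    (hA : AssumptionA1 μ Z S δ a b d ε) {Φ : ℝ → ℝ} (hΦ : ConvexOn ℝ (Set.Ici 0) Φ)
    (hmono : MonotoneOn Φ (Set.Ici 0)) (hΦ0 : ∀ x, 0 ≤ x → 0 ≤ Φ x) (m : ℕ → ℝ) :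
    ∀ᶠ n : ℕ in atTop, 7 / 20 * localConst q * Φ (ε * Real.sqrt (2 * α * n) / 16) ≤
      ∫ ω, Φ |optScore S δ (word Z n ω) - m n| ∂μ := by
  classical
  obtain ⟨Δ, hΔ, hΔn⟩ := hA
  have hβ := localConst_pos h0 h1
  have hK0 : 0 ≤ 2 * ∑ x, ∑ y, (S x y : ℝ) := mul_nonneg zero_le_two <|
    Finset.sum_nonneg fun _ _ => Finset.sum_nonneg fun _ _ => NNReal.coe_nonneg _
  set K := 2 * ∑ x, ∑ y, (S x y : ℝ) with hK
  set η := ε / 100 * localConst q / (K + ε) with hη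
  have hKε : 0 < K + ε := by linarith
  have hη0 : 0 < η := by positivity
  have hηle : (K + ε) * η / localConst q ≤ ε / 100 := by
    rw [hη]
    field_simp
    exact le_rfl
  have hV := (hZ.tendsto_measureReal_statV_lt a b hα0 hα).eventually_le_const
    (show (0 : ℝ) < 1 / 4 by norm_num)
  -- The total mass of bad words is at most `η / 4`, so the values `v` whose conditional bad mass
  -- exceeds `η` have total mass at most 1/4.
  have hD := hΔ.eventually_le_const (show (0 : ℝ) < η / 4 by positivity)
  have hsqrt : Tendsto (fun n : ℕ => Real.sqrt (α * n / 2)) atTop atTop := by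
    refine Real.tendsto_sqrt_atTop.comp ?_
    have : Tendsto (fun n : ℕ => α / 2 * (n : ℝ)) atTop atTop :=
      tendsto_natCast_atTop_atTop.const_mul_atTop (by positivity)
    refine this.congr fun n => ?_
    ring
  filter_upwards [hV, hD, hsqrt.eventually_ge_atTop 50,
    hsqrt.eventually_ge_atTop (4 / (q * (1 - q)))] with n hVn hDn hn50 hn4
  rw [hZ.chain.measureReal_word n fun z => (statV a b z : ℝ) < α * n / 2] at hVn
  have hA1 := hΔn n
  rw [hZ.chain.measureReal_word n fun z => ε ≤ expectedGain S δ a b d z] at hA1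
  have hW : ∀ z : Fin n → A × A, 0 ≤ wordProb μ Z z := wordProb_nonneg
  set p : ℕ → ℝ := fun v => ∑ z ∈ vLevel n a b v, wordProb μ Z z with hp
  set r : ℕ → ℝ := fun v => ∑ z ∈ vLevel n a b v, wordProb μ Z z *
      (if expectedGain S δ a b d z < ε then 1 else 0) with hr
  have hp0 : ∀ v, 0 ≤ p v := fun v => Finset.sum_nonneg fun z _ => hW z
  have hr0 : ∀ v, 0 ≤ r v := fun v => Finset.sum_nonneg fun z _ => mul_nonneg (hW z) (by
    split_ifs <;> norm_num)
  have hpsum : ∑ v ∈ Finset.range (n + 1), p v = 1 := by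
    rw [← hZ.chain.sum_wordProb n, sum_eq_sum_vLevel n a b]
  have hrsum : ∑ v ∈ Finset.range (n + 1), r v ≤ η / 4 := by
    rw [← sum_eq_sum_vLevel n a b]
    have e : ∑ z : Fin n → A × A, wordProb μ Z z *
          (if expectedGain S δ a b d z < ε then (1 : ℝ) else 0) +
        ∑ z : Fin n → A × A, wordProb μ Z z * (if ε ≤ expectedGain S δ a b d z then 1 else 0) =
        1 := by
      refine Eq.trans ?_ (hZ.chain.sum_wordProb n)
      rw [← Finset.sum_add_distrib]
      refine Finset.sum_congr rfl fun z _ => ?_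
      rw [← mul_add]
      by_cases h : ε ≤ expectedGain S δ a b d z
      · rw [if_neg h.not_gt, if_pos h, zero_add, mul_one]
      · rw [if_pos (not_le.1 h), if_neg h, add_zero, mul_one]
    linarith
  have hlow : ∑ v ∈ (Finset.range (n + 1)).filter (fun v : ℕ => ¬ α * n / 2 ≤ (v : ℝ)), p v ≤ 1 / 4 := by
    refine le_trans ?_ hVn
    rw [sum_eq_sum_vLevel n a b, Finset.sum_filter]
    refine Finset.sum_le_sum fun v _ => ?_
    by_cases h : ¬ α * n / 2 ≤ (v : ℝ)
    · rw [if_pos h]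
      refine le_of_eq (Finset.sum_congr rfl fun z hz => ?_)
      have hz' : statV a b z = v := by simpa [vLevel] using hz
      rw [hz', if_pos (not_le.1 h), mul_one]
    · rw [if_neg h]
      exact Finset.sum_nonneg fun z _ => mul_nonneg (hW z) (by split_ifs <;> norm_num)
  have hbad : ∑ v ∈ (Finset.range (n + 1)).filter (fun v => ¬ r v ≤ η * p v), p v ≤ 1 / 4 := by
    refine le_of_mul_le_mul_left ?_ hη0
    rw [Finset.mul_sum]
    calc _ ≤ ∑ v ∈ (Finset.range (n + 1)).filter (fun v => ¬ r v ≤ η * p v), r v :=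
          Finset.sum_le_sum fun v hv => (not_le.1 (Finset.mem_filter.1 hv).2).le
      _ ≤ ∑ v ∈ Finset.range (n + 1), r v :=
          Finset.sum_le_sum_of_subset_of_nonneg (Finset.filter_subset _ _) fun v _ _ => hr0 v
      _ ≤ η * (1 / 4) := by linarith
  -- Small values of `V` and values with too many bad words cost at most 1/4 each. The remaining
  -- mass 1/2 turns `7 / 10` into `7 / 20`.
  set G := (Finset.range (n + 1)).filter fun v : ℕ => α * n / 2 ≤ (v : ℝ) ∧ r v ≤ η * p v with hG
  have hGsum : 1 / 2 ≤ ∑ v ∈ G, p v := by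
    have e1 : ∑ v ∈ Finset.range (n + 1), p v ≤ ∑ v ∈ G, p v +
        (∑ v ∈ (Finset.range (n + 1)).filter (fun v : ℕ => ¬ α * n / 2 ≤ (v : ℝ)), p v +
        ∑ v ∈ (Finset.range (n + 1)).filter (fun v => ¬ r v ≤ η * p v), p v) := by
      rw [hG, Finset.sum_filter, Finset.sum_filter, Finset.sum_filter, ← Finset.sum_add_distrib,
        ← Finset.sum_add_distrib]
      refine Finset.sum_le_sum fun v _ => ?_
      have := hp0 v
      by_cases h2 : α * n / 2 ≤ (v : ℝ) <;> by_cases h3 : r v ≤ η * p v <;> simp [h2, h3, this]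
    linarith
  have hx0 : 0 ≤ ε * Real.sqrt (2 * α * n) / 16 := by positivity
  set x := ε * Real.sqrt (2 * α * n) / 16 with hx
  have hxx : x = ε * Real.sqrt (α * n / 2) / 8 := by
    have : Real.sqrt (2 * α * n) = 2 * Real.sqrt (α * n / 2) := by
      rw [show 2 * α * n = 2 ^ 2 * (α * n / 2) by ring, Real.sqrt_mul (by norm_num),
        Real.sqrt_sq (by norm_num)]
    rw [hx, this]
    ring
  have hc : 0 ≤ 7 / 10 * localConst q * Φ x := mul_nonneg (by positivity) (hΦ0 x hx0)
  rw [hZ.chain.integral_word n fun z => Φ |optScore S δ z - m n|, sum_eq_sum_vLevel n a b]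
  calc 7 / 20 * localConst q * Φ x = 7 / 10 * localConst q * Φ x * (1 / 2) := by ring
    _ ≤ 7 / 10 * localConst q * Φ x * ∑ v ∈ G, p v := mul_le_mul_of_nonneg_left hGsum hc
    _ = ∑ v ∈ G, 7 / 10 * localConst q * Φ x * p v := Finset.mul_sum _ _ _
    _ ≤ ∑ v ∈ G, ∑ z ∈ vLevel n a b v, wordProb μ Z z * Φ |optScore S δ z - m n| := by
        refine Finset.sum_le_sum fun v hv => ?_
        obtain ⟨-, hv1, hv2⟩ := Finset.mem_filter.1 hv
        have hs := Real.sqrt_le_sqrt hv1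
        refine le_sum_vLevel hZ.chain S δ hq h0 h1 hε hηle (hn4.trans hs) (hn50.trans hs) hx0 ?_ n
          hv2 hΦ hmono hΦ0 (m n)
        rw [hxx]
        have := mul_le_mul_of_nonneg_left hs hε.le
        linarith
    _ ≤ _ := Finset.sum_le_sum_of_subset_of_nonneg (Finset.filter_subset _ _) fun v _ _ =>
        Finset.sum_nonneg fun z _ => mul_nonneg (hW z) (hΦ0 _ (abs_nonneg _))

/-- After the common factor `exp (-(1 / (2 * q * (1 - q)))) / (8 * √(q * (1 - q)))` is removed, the
claim is `√(2 * α) / √(2 * π) ≤ 7 / 20`. It holds since `√(2 * α) ≤ 0.82` for `α ≤ 1 / 3` and `√(2 *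
π) ≥ 2.5`. -/
theorem bConst_inv_mul_le {q α : ℝ} (h0 : 0 < q) (h1 : q < 1) (hα : α ≤ 1 / 3) :
    (bConst q)⁻¹ * Real.sqrt (2 * α) / 8 ≤ 7 / 20 * localConst q := by
  have hq1 : 0 < 1 - q := by linarith
  have hx0 : 0 < q * (1 - q) := by positivity
  have hσ : 0 < Real.sqrt (q * (1 - q)) := Real.sqrt_pos.2 hx0
  have e1 : Real.sqrt (2 * Real.pi * q * (1 - q)) =
      Real.sqrt (2 * Real.pi) * Real.sqrt (q * (1 - q)) := by
    rw [← Real.sqrt_mul (by positivity), mul_assoc (2 * Real.pi)]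
  have hpi : 5 / 2 ≤ Real.sqrt (2 * Real.pi) := by
    refine Real.le_sqrt_of_sq_le ?_
    linarith [Real.pi_gt_d2]
  have hsα : Real.sqrt (2 * α) ≤ 41 / 50 := by
    rw [Real.sqrt_le_iff]
    constructor
    · norm_num
    · linarith
  rw [bConst, localConst, e1, Real.exp_neg, mul_assoc 2 q (1 - q)]
  set E := Real.exp (1 / (2 * (q * (1 - q))))
  have hE : 0 < E := Real.exp_pos _
  set σ := Real.sqrt (q * (1 - q))
  have hp : 0 < Real.sqrt (2 * Real.pi) := by linarith
  have : (Real.sqrt (2 * Real.pi))⁻¹ * Real.sqrt (2 * α) ≤ 7 / 20 := by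
    rw [inv_mul_le_iff₀ hp]
    linarith
  calc _ = (Real.sqrt (2 * Real.pi))⁻¹ * Real.sqrt (2 * α) * (E⁻¹ / (8 * σ)) := by
        field_simp
    _ ≤ _ := mul_le_mul_of_nonneg_right this (by positivity)

end LowerBound

end PairwiseMarkov

/-! ### The theorem and its power and variance cases -/

open PairwiseMarkov in
theorem theorem3p1 {A Ω : Type*} [Fintype A] [DecidableEq A]
    [MeasurableSpace A] [MeasurableSingletonClass A]
    [MeasurableSpace Ω] (P : Measure Ω) [IsProbabilityMeasure P]
    (Z : ℕ → Ω → A × A) (p : Matrix (A × A) (A × A) ℝ)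
    (hZ : IsStationaryAperiodicChain P Z p)
    (S : A → A → ℝ≥0) (δ : ℝ)
    (a b d : A × A) (hab : 0 < P.real {ω | Z 0 ω = a ∧ Z 2 ω = b})
    (q : ℝ) (hq : q = midProb p a b d) (hq0 : 0 < q)
    (α : ℝ) (hα : α = P.real {ω | Z 0 ω = a ∧ Z 2 ω = b} / 3)
    (ε : ℝ) (hε : 0 < ε) (hA1 : AssumptionA1 P Z S δ a b d ε)
    (c : ℝ) (hc0 : 0 < c) (hc : c < (bConst q)⁻¹ * Real.sqrt (2 * α) / 8) :
    (∀ Φ : ℝ → ℝ, ConvexOn ℝ (Set.Ici 0) Φ → MonotoneOn Φ (Set.Ici 0) →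
      (∀ x, 0 ≤ x → 0 ≤ Φ x) → ∀ m : ℕ → ℝ, ∀ᶠ n : ℕ in atTop,
        c * Φ (ε * Real.sqrt (2 * α * n) / 16) ≤
          ∫ ω, Φ |optScore S δ (word Z n ω) - m n| ∂P) ∧
    (∀ r : ℝ, 1 ≤ r → ∀ᶠ n : ℕ in atTop,
      c * (ε * Real.sqrt (2 * α) / 16) ^ r * (n : ℝ) ^ (r / 2) ≤
        ∫ ω, |optScore S δ (word Z n ω) -
          ∫ ω', optScore S δ (word Z n ω') ∂P| ^ r ∂P) ∧
    (∀ᶠ n : ℕ in atTop,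
      2 * c * α / 16 ^ 2 * ε ^ 2 * n ≤
        variance (fun ω => optScore S δ (word Z n ω)) P) := by
  have hα0 : 0 < α := by rw [hα]; positivity
  have hα3 : α ≤ 1 / 3 := by
    rw [hα]
    have : P.real {ω | Z 0 ω = a ∧ Z 2 ω = b} ≤ 1 := measureReal_le_one
    linarith
  have hq1 : q < 1 := hq ▸ hA1.midProb_lt_one hZ.chain hε
  have hcle := hc.le.trans (bConst_inv_mul_le hq0 hq1 hα3)
  have main : ∀ Φ : ℝ → ℝ, ConvexOn ℝ (Set.Ici 0) Φ → MonotoneOn Φ (Set.Ici 0) →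
      (∀ x, 0 ≤ x → 0 ≤ Φ x) → ∀ m : ℕ → ℝ, ∀ᶠ n : ℕ in atTop,
        c * Φ (ε * Real.sqrt (2 * α * n) / 16) ≤
          ∫ ω, Φ |optScore S δ (word Z n ω) - m n| ∂P := by
    intro Φ hΦ hmono hΦ0 m
    filter_upwards [hZ.eventually_le_integral S δ hq hq0 hq1 hα0 hα hε hA1 hΦ hmono hΦ0 m]
      with n hn
    exact (mul_le_mul_of_nonneg_right hcle (hΦ0 _ (by positivity))).trans hn
  have power : ∀ r : ℝ, 1 ≤ r → ∀ᶠ n : ℕ in atTop,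
      c * (ε * Real.sqrt (2 * α) / 16) ^ r * (n : ℝ) ^ (r / 2) ≤
        ∫ ω, |optScore S δ (word Z n ω) -
          ∫ ω', optScore S δ (word Z n ω') ∂P| ^ r ∂P := by
    intro r hr
    filter_upwards [main (fun x => x ^ r) (convexOn_rpow hr)
      (Real.monotoneOn_rpow_Ici_of_exponent_nonneg (by linarith))
      (fun x hx => Real.rpow_nonneg hx r)
      (fun n => ∫ ω', optScore S δ (word Z n ω') ∂P)] with n hn
    have e : (ε * Real.sqrt (2 * α * n) / 16) ^ r =
        (ε * Real.sqrt (2 * α) / 16) ^ r * (n : ℝ) ^ (r / 2) := by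
      have h1 : ε * Real.sqrt (2 * α * n) / 16 = ε * Real.sqrt (2 * α) / 16 * Real.sqrt n := by
        rw [Real.sqrt_mul (by positivity)]
        ring
      rw [h1, Real.mul_rpow (by positivity) (by positivity), Real.sqrt_eq_rpow (n : ℝ),
        ← Real.rpow_mul (by positivity)]
      congr 2
      ring
    rw [mul_assoc, ← e]
    exact hn
  refine ⟨main, power, ?_⟩
  -- The variance is the second centred absolute moment; the remaining work converts real powers to
  -- squares.
  filter_upwards [power 2 one_le_two] with n hn
  have hmeas : Measurable fun ω => optScore S δ (word Z n ω) :=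
    (measurable_of_finite fun z : Fin n → A × A => optScore S δ z).comp (hZ.chain.measurable_word n)
  rw [variance_eq_integral hmeas.aemeasurable]
  have e1 : c * (ε * Real.sqrt (2 * α) / 16) ^ (2 : ℝ) * (n : ℝ) ^ ((2 : ℝ) / 2) =
      2 * c * α / 16 ^ 2 * ε ^ 2 * n := by
    rw [div_self two_ne_zero, Real.rpow_one, Real.rpow_two, div_pow, mul_pow,
      Real.sq_sqrt (by positivity)]
    ring
  rw [← e1]
  refine hn.trans (le_of_eq ?_)
  congr 1
  ext ω
  rw [Real.rpow_two, sq_abs]
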